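/- Let $G$ be a separable locally compact (Hausdorff) group and let $S\subset G$ be a compact symmetric generating set containing the identity. All Banach spaces are complex; a representation $(\pi,E)$ of a topological group is a homomorphism $\pi$ into the group of bounded invertible operators of a Banach space $E$ such that $g\mapsto\pi(g)x$ is continuous for every $x\in E$, and $E^\pi$ is the space of invariant vectors. Write $\pi(f)x=\int f(g)\pi(g)x\,dg$ for $f\in C_c(G)$, with $dg$ a left Haar measure. Fix $M>1$ and let $\mathcal R$ be the set of equivalence classes (up to equivariant surjective linear isometries) of representations $(\pi,E)$ of $G$ on separable Banach spaces with $\sup_{g\in S}\|\pi(g)\|\le M$. Give $\mathcal R$ the topology with basis the sets $W_{x_1,\dots,x_n,Q,\varepsilon}(\pi,E)$, where $(\pi,E)\in\mathcal R$, $x_1,\dots,x_n\in E$, $Q\subset G$ is compact and $\varepsilon>0$, consisting of all $(\pi',E')\in\mathcal R$ for which there are $x_1',\dots,x_n'\in E'$ with $$\sup_{f_1,\dots,f_n}\Big|\,\Big\|\sum_k\pi'(f_k)x_k'\Big\|-\Big\|\sum_k\pi(f_k)x_k\Big\|\,\Big|<\varepsilon ,$$ the supremum being over all $f_k\in C_c(G)$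 supported in $Q$ with $\|f_k\|_{L_1}\le1$. For $\mathcal F\subset\mathcal R$ and a quotient $H$ of $G$, let $\mathcal F_{[H]}$ be the set of representations in $\mathcal F$ that factor through $H$, viewed as representations of $H$. For a family $\mathcal F'$ of representations of a locally compact group $H$ that is uniformly bounded on compact sets, $\mathcal C_{\mathcal F'}(H)$ is the completion of the convolution algebra $C_c(H)$ for the norm $\|f\|=\sup_{(\pi,E)\in\mathcal F'}\|\pi(f)\|$. A Kazhdan projection in $\mathcal C_{\mathcal F'}(H)$ is an idempotent $p$ in the closure of $\{f\in C_c(H):\int f=1\}$ such that $\pi(p)$ is a projection onto $E^\pi$ for every $(\pi,E)\in\mathcal F'$. Further, $H^1(H;\pi)$ is the space of continuous cocycles $b\colon H\to E$, $b(gh)=b(g)+\pi(g)b(h)$, modulo those of the form $b(g)=x-\pi(g)x$ with $x\in E$. A locally compact group is compactly presented if it has a compact generating set $T$ and, as an abstract group, a presentation with $T$ as set of generators and relators of bounded length. **Theorem.** Assume that $G$ is compactly presented, that $H=G/N$ for a discrete normal subgroup $N$ of $G$, and that $\mathcal F\subset\mathcal R$ is closed. If $\mathcal C_{\mathcal F_{[H]}}(H)$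 has a Kazhdan projection and $H^1(H;\pi)=0$ for every $(\pi,E)\in\mathcal F_{[H]}$, then there is a normal subgroup $N'$ of $G$ with $N'\subset N$ such that the intermediate quotient $H'=G/N'$ (so $G\to H'\to H$) is compactly presented, $\mathcal C_{\mathcal F_{[H']}}(H')$ has a Kazhdan projection, and $H^1(H';\pi)=0$ for every $(\pi,E)\in\mathcal F_{[H']}$. -/

import Mathlib

open MeasureTheory Topology
open scoped ENNReal CompactlySupported

/-! ### Compact presentation -/

/-- `G` is compactly presented: it has a compact generating set `T` and, as an abstract group, a
presentation with `T` as set of generators and with relators (words in the letters of `T` and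
their inverses) of bounded length. -/
def IsCompactlyPresented (G : Type*) [Group G] [TopologicalSpace G] : Prop :=
  ∃ T : Set G, IsCompact T ∧ Subgroup.closure T = ⊤ ∧
    ∃ (n : ℕ) (R : Set (List (T × Bool))), (∀ w ∈ R, w.length ≤ n) ∧
      (FreeGroup.lift (fun t : T => (t : G))).ker = Subgroup.normalClosure (FreeGroup.mk '' R)

/-! ### Representations on separable Banach spaces -/

/-- A strongly continuous representation of `G` on a separable complex Banach space. A separable
Banach space has at most continuum many points, so every such representation is equivalent
(through an isometry) to one whose space lives in `Type`. The operators are invertible because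
`G` is a group. -/
structure BanachRep (G : Type*) [Group G] [TopologicalSpace G] where
  E : Type
  [normed : NormedAddCommGroup E]
  [space : NormedSpace ℂ E]
  [complete : CompleteSpace E]
  [separable : TopologicalSpace.SeparableSpace E]
  toHom : G →* (E →L[ℂ] E)
  continuous_orbit : ∀ x : E, Continuous fun g => toHom g x

attribute [instance] BanachRep.normed BanachRep.space BanachRep.complete BanachRep.separable

/-- Integration over `G` against (Mathlib's choice of) left Haar measure on the Borel sets. -/
noncomputable def haarIntegral {G : Type*} [Group G] [TopologicalSpace G] [IsTopologicalGroup G]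
    [LocallyCompactSpace G] {E : Type*} [NormedAddCommGroup E] [NormedSpace ℝ E]
    (φ : G → E) : E :=
  letI : MeasurableSpace G := borel G
  haveI : BorelSpace G := ⟨rfl⟩
  ∫ g, φ g ∂Measure.haar

namespace BanachRep

variable {G : Type*} [Group G] [TopologicalSpace G]

/-- The space of invariant vectors. -/
def invariants (ρ : BanachRep G) : Submodule ℂ ρ.E where
  carrier := {x | ∀ g, ρ.toHom g x = x}
  add_mem' := by
    intro x y hx hy g
    rw [map_add, hx g, hy g]
  zero_mem' := fun g => map_zero _
  smul_mem' := by
    intro c x hx g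
    rw [map_smul, hx g]

/-- Continuous cocycles: the translation parts of continuous affine actions with linear
part `ρ`. -/
def Z1 (ρ : BanachRep G) : Submodule ℂ (G → ρ.E) where
  carrier := {b | Continuous b ∧ ∀ g h, b (g * h) = b g + ρ.toHom g (b h)}
  add_mem' := by
    rintro a b ⟨ha, ha'⟩ ⟨hb, hb'⟩
    refine ⟨ha.add hb, fun g h => ?_⟩
    simp only [Pi.add_apply, ha', hb', map_add]
    abel
  zero_mem' := ⟨continuous_const, by simp⟩
  smul_mem' := by
    rintro c b ⟨hb, hb'⟩
    refine ⟨hb.const_smul c, fun g h => ?_⟩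
    simp only [Pi.smul_apply, hb', map_smul, smul_add]

/-- Coboundaries: the functions `g ↦ x - ρ(g) x`. -/
def B1 (ρ : BanachRep G) : Submodule ℂ (G → ρ.E) where
  carrier := {b | ∃ x : ρ.E, ∀ g, b g = x - ρ.toHom g x}
  add_mem' := by
    rintro a b ⟨x, hx⟩ ⟨y, hy⟩
    refine ⟨x + y, fun g => ?_⟩
    simp only [Pi.add_apply, hx, hy, map_add]
    abel
  zero_mem' := ⟨0, by simp⟩
  smul_mem' := by
    rintro c b ⟨x, hx⟩
    refine ⟨c • x, fun g => ?_⟩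
    simp only [Pi.smul_apply, hx, map_smul, smul_sub]

/-- The first cohomology `H¹(G; ρ) = Z¹ / B¹`. -/
abbrev H1 (ρ : BanachRep G) : Type _ := ρ.Z1 ⧸ ρ.B1.submoduleOf ρ.Z1

/-- The representation of `G` defined by a representation of the quotient `G ⧸ N`. -/
def pullback (N : Subgroup G) [N.Normal] (σ : BanachRep (G ⧸ N)) : BanachRep G where
  E := σ.E
  toHom := σ.toHom.comp (QuotientGroup.mk' N)
  continuous_orbit x := (σ.continuous_orbit x).comp continuous_quot_mk

/-- Equivalence: a surjective linear isometry that intertwines the actions. -/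
def Equivalent (ρ ρ' : BanachRep G) : Prop :=
  ∃ u : ρ.E ≃ₗᵢ[ℂ] ρ'.E, ∀ g x, u (ρ.toHom g x) = ρ'.toHom g (u x)

theorem continuous_weighted (ρ : BanachRep G) (f : C_c(G, ℂ)) (x : ρ.E) :
    Continuous fun g => f g • ρ.toHom g x :=
  f.continuous.smul (ρ.continuous_orbit x)

theorem hasCompactSupport_weighted (ρ : BanachRep G) (f : C_c(G, ℂ)) (x : ρ.E) :
    HasCompactSupport fun g => f g • ρ.toHom g x :=
  f.hasCompactSupport.smul_right (f' := fun g => ρ.toHom g x)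

variable [IsTopologicalGroup G] [LocallyCompactSpace G]

theorem exists_bound_weighted (ρ : BanachRep G) (f : C_c(G, ℂ)) :
    ∃ C : ℝ, ∀ x, ‖haarIntegral fun g => f g • ρ.toHom g x‖ ≤ C * ‖x‖ := by
  obtain ⟨C, hC⟩ : ∃ C, ∀ g : tsupport f, ‖ρ.toHom g‖ ≤ C := by
    refine banach_steinhaus fun x => ?_
    obtain ⟨C, hC⟩ := IsCompact.exists_bound_of_continuousOn
      (s := tsupport f) f.hasCompactSupport (ρ.continuous_orbit x).continuousOn
    exact ⟨C, fun g => hC g g.2⟩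
  let _ : MeasurableSpace G := borel G
  have _ : BorelSpace G := ⟨rfl⟩
  refine ⟨(∫ g, ‖f g‖ ∂Measure.haar) * C, fun x => ?_⟩
  have hint : Integrable (fun g => ‖f g‖) (Measure.haar : Measure G) :=
    (f.continuous.integrable_of_hasCompactSupport f.hasCompactSupport).norm
  have h : ‖∫ g, f g • ρ.toHom g x ∂Measure.haar‖ ≤ ∫ g, ‖f g‖ * (C * ‖x‖) ∂Measure.haar := by
    refine norm_integral_le_of_norm_le (hint.mul_const _) (Filter.Eventually.of_forall fun g => ?_)
    by_cases hg : g ∈ tsupport f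
    · rw [norm_smul]
      exact mul_le_mul_of_nonneg_left (((ρ.toHom g).le_opNorm x).trans
        (mul_le_mul_of_nonneg_right (hC ⟨g, hg⟩) (norm_nonneg _))) (norm_nonneg _)
    · simp [image_eq_zero_of_notMem_tsupport hg]
  rw [integral_mul_const, ← mul_assoc] at h
  exact h

/-- The bounded operator `ρ(f) x = ∫ f(g) ρ(g) x dg`, for `f ∈ C_c(G)`. -/
noncomputable def op (ρ : BanachRep G) (f : C_c(G, ℂ)) : ρ.E →L[ℂ] ρ.E :=
  LinearMap.mkContinuousOfExistsBound
    { toFun := fun x => haarIntegral fun g => f g • ρ.toHom g x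
      map_add' := by
        intro x y
        let _ : MeasurableSpace G := borel G
        have _ : BorelSpace G := ⟨rfl⟩
        simp only [map_add, smul_add]
        exact integral_add
          ((ρ.continuous_weighted f x).integrable_of_hasCompactSupport
            (ρ.hasCompactSupport_weighted f x))
          ((ρ.continuous_weighted f y).integrable_of_hasCompactSupport
            (ρ.hasCompactSupport_weighted f y))
      map_smul' := by
        intro c x
        let _ : MeasurableSpace G := borel G
        have _ : BorelSpace G := ⟨rfl⟩
        simp only [map_smul, RingHom.id_apply, smul_comm _ c]
        exact integral_smul c _ }
    (ρ.exists_bound_weighted f)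

theorem op_apply (ρ : BanachRep G) (f : C_c(G, ℂ)) (x : ρ.E) :
    ρ.op f x = haarIntegral fun g => f g • ρ.toHom g x := rfl

end BanachRep

/-! ### The algebra `C_F(G)` and Kazhdan projections -/

section Kazhdan

variable {G : Type*} [Group G] [TopologicalSpace G] [IsTopologicalGroup G]
  [LocallyCompactSpace G]

/-- Families of operators indexed by `F`, multiplied (composed) coordinatewise. -/
abbrev OpFamily (F : Set (BanachRep G)) : Type _ := ∀ ρ : F, ρ.1.E →L[ℂ] ρ.1.E

/-- The (extended) distance on families for the norm `sup_{ρ ∈ F} ‖·‖`. -/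
noncomputable def OpFamily.supDist {F : Set (BanachRep G)} (p q : OpFamily F) : ℝ≥0∞ :=
  ⨆ ρ : F, ‖p ρ - q ρ‖ₑ

/-- The image `(ρ(f))_{ρ ∈ F}` of `f ∈ C_c(G)`. It turns convolution into composition, and the
distance of the images of `f₁` and `f₂` is `‖f₁ - f₂‖_F = sup_{ρ ∈ F} ‖ρ(f₁ - f₂)‖`. -/
noncomputable def OpFamily.ofFun (F : Set (BanachRep G)) (f : C_c(G, ℂ)) : OpFamily F :=
  fun ρ => ρ.1.op f

/-- The closure, for `‖·‖_F`, of a set `A` of functions of `C_c(G)` in the completion `C_F(G)` of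
`C_c(G)`. The map `f ↦ (ρ(f))_{ρ ∈ F}` is isometric for `‖·‖_F` and the space of all families is
complete for uniform convergence, so the completion `C_F(G)` is the uniform closure of the image
of `C_c(G)`; in this model the extension of `ρ ∈ F` to `C_F(G)` is the `ρ`-th coordinate `p ↦ p ρ`,
and the product is the coordinatewise one. -/
def closureInCF (F : Set (BanachRep G)) (A : Set C_c(G, ℂ)) : Set (OpFamily F) :=
  {p | ∀ ε : ℝ≥0∞, 0 < ε → ∃ f ∈ A, OpFamily.supDist p (OpFamily.ofFun F f) < ε}

/-- The Banach algebra `C_F(G)`. -/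
def CF (F : Set (BanachRep G)) : Set (OpFamily F) := closureInCF F Set.univ

/-- `p` is a Kazhdan projection in `C_F(G)`: an idempotent in the closure of
`{f ∈ C_c(G), ∫ f = 1}` such that `ρ(p)` is a projection on `E^ρ` for every `ρ ∈ F`. -/
structure IsKazhdanProjection (F : Set (BanachRep G)) (p : OpFamily F) : Prop where
  mem : p ∈ CF F
  idempotent : IsIdempotentElem p
  mem_closure : p ∈ closureInCF F {f | haarIntegral (fun g => f g) = 1}
  projection : ∀ ρ : F, IsIdempotentElem (p ρ) ∧
    LinearMap.range (p ρ).toLinearMap = ρ.1.invariants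

/-- `C_F(G)` has a Kazhdan projection. -/
def HasKazhdanProjection (F : Set (BanachRep G)) : Prop :=
  ∃ p : OpFamily F, IsKazhdanProjection F p

end Kazhdan

/-! ### The space `R` of representations bounded by `M` on `S`, and its topology -/

/-- The space `R` of representations on separable Banach spaces with `sup_{g ∈ S} ‖ρ(g)‖ ≤ M`.
We work with the representations themselves and not with their equivalence classes: closed
subsets for the topology below are stable under equivalence (`BddRep.mem_of_equivalent`), so they
are the same thing as closed sets of equivalence classes. -/
def BddRep {G : Type*} [Group G] [TopologicalSpace G] (S : Set G) (M : ℝ) : Type _ :=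
  {ρ : BanachRep G // ∀ g ∈ S, ‖ρ.toHom g‖ ≤ M}

namespace BddRep

variable {G : Type*} [Group G] [TopologicalSpace G] {S : Set G} {M : ℝ}

/-- `F_[G ⧸ N]`: the representations in `F` that factor through `G ⧸ N`, seen as representations
of `G ⧸ N`. -/
def factoring (F : Set (BddRep S M)) (N : Subgroup G) [N.Normal] : Set (BanachRep (G ⧸ N)) :=
  {σ | ∃ h : ∀ g ∈ S, ‖(σ.pullback N).toHom g‖ ≤ M, (⟨σ.pullback N, h⟩ : BddRep S M) ∈ F}

variable [IsTopologicalGroup G] [LocallyCompactSpace G]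

/-- The set `W_{x₁,…,xₙ,Q,ε}(ρ)` of all `ρ'` for which there are `x'₁,…,x'ₙ` such that
`sup_{f₁,…,fₙ} |‖∑ ρ'(fₖ) x'ₖ‖ - ‖∑ ρ(fₖ) xₖ‖| < ε`, the supremum being over the `fₖ ∈ C_c(G)`
supported in `Q` with `‖fₖ‖_{L₁} ≤ 1`. -/
def basicNhd (ρ : BddRep S M) {n : ℕ} (x : Fin n → ρ.1.E) (Q : Set G) (ε : ℝ) :
    Set (BddRep S M) :=
  {ρ' | ∃ x' : Fin n → ρ'.1.E, ∃ δ < ε, ∀ f : Fin n → C_c(G, ℂ),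
    (∀ k, tsupport (f k) ⊆ Q ∧ haarIntegral (fun g => ‖f k g‖) ≤ 1) →
      |‖∑ k, ρ'.1.op (f k) (x' k)‖ - ‖∑ k, ρ.1.op (f k) (x k)‖| ≤ δ}

/-- The topology with basis the sets `W_{x₁,…,xₙ,Q,ε}(ρ)`, `Q` compact and `ε > 0`. -/
instance : TopologicalSpace (BddRep S M) :=
  TopologicalSpace.generateFrom
    {U | ∃ (ρ : BddRep S M) (n : ℕ) (x : Fin n → ρ.1.E) (Q : Set G) (ε : ℝ),
      IsCompact Q ∧ 0 < ε ∧ U = basicNhd ρ x Q ε}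

theorem mem_basicNhd_of_equivalent {ρ₁ ρ₂ : BddRep S M} (h : ρ₁.1.Equivalent ρ₂.1)
    (ρ : BddRep S M) {n : ℕ} (x : Fin n → ρ.1.E) (Q : Set G) (ε : ℝ)
    (h₁ : ρ₁ ∈ basicNhd ρ x Q ε) : ρ₂ ∈ basicNhd ρ x Q ε := by
  obtain ⟨u, hu⟩ := h
  obtain ⟨x', δ, hδ, hx'⟩ := h₁
  refine ⟨fun k => u (x' k), δ, hδ, fun f hf => ?_⟩
  have key : ∀ (f : C_c(G, ℂ)) (y : ρ₁.1.E), ρ₂.1.op f (u y) = u (ρ₁.1.op f y) := by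
    intro f y
    let _ : MeasurableSpace G := borel G
    have _ : BorelSpace G := ⟨rfl⟩
    have e : ∀ g, f g • ρ₂.1.toHom g (u y) = u (f g • ρ₁.1.toHom g y) := by
      intro g
      rw [map_smul, hu]
    simp only [BanachRep.op_apply, e]
    exact u.toContinuousLinearEquiv.integral_comp_comm _
  simp only [key, ← map_sum, LinearIsometryEquiv.norm_map]
  exact hx' f hf

theorem mem_of_equivalent {F : Set (BddRep S M)} (hF : IsClosed F) {ρ₁ ρ₂ : BddRep S M}
    (h : ρ₁.1.Equivalent ρ₂.1) (h₁ : ρ₁ ∈ F) : ρ₂ ∈ F := by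
  by_contra h₂
  have hsymm : ρ₂.1.Equivalent ρ₁.1 := by
    obtain ⟨u, hu⟩ := h
    refine ⟨u.symm, fun g x => ?_⟩
    rw [LinearIsometryEquiv.symm_apply_eq, hu, LinearIsometryEquiv.apply_symm_apply]
  have key : ∀ U : Set (BddRep S M), IsOpen U → ρ₂ ∈ U → ρ₁ ∈ U := by
    intro U hU
    induction hU with
    | basic U hU =>
      obtain ⟨ρ, n, x, Q, ε, -, -, rfl⟩ := hU
      exact mem_basicNhd_of_equivalent hsymm ρ x Q ε
    | univ => exact fun _ => trivial
    | inter U V _ _ hU hV => exact fun hm => ⟨hU hm.1, hV hm.2⟩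
    | sUnion 𝒰 _ ih => exact fun ⟨U, hU, hm⟩ => ⟨U, hU, ih U hU hm⟩
  exact key _ hF.isOpen_compl h₂ h₁

end BddRep

/-! A cocycle `b` for `π` is the orbit of 0 under the affine action `g·x = π(g)x + b(g)`, and it is
a coboundary exactly when this action has a fixed point. The existence of a Kazhdan projection and
the vanishing of H¹ are together equivalent to one quantitative property: a single `f` in `C_c` with
`∫ f = 1` such that, for all representations of the family and all cocycles, moving the base point
from 0 to `∫ f b` halves the bound on the displacement over the generating set. In one direction
(`exists_contracting_of_kazhdan`) every contraction factor can be reached. In the other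
(`kazhdan_of_contracting`), iterating the halving leads to a fixed point, and for linear actions it
makes `π(f)^n` converge geometrically to a projection on the invariant vectors.

Such a contraction survives small changes of the group. The discrete group `N` is exhausted by
finite sets; let `N_m` be their normal closures. Each `G/N_m` is compactly presented, since finitely
many relators are added to `G`. If the contraction failed for all `m` (`BddRep.exists_contracting`),
there would be representations in `F` and cocycles, trivial on `N_m`, violating it. Their ultralimit
is trivial on `N`, because each element of `N` eventually lies in `N_m`; it belongs to `F` because
`F` is closed (`BddRep.ultralimit_mem`); and it contradicts the contraction for `G/N`.

The difficulty is continuity: cocycles bounded on `S` need not be equicontinuous. Moving the base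
point to `∫ φ b`, for a fixed `φ`, gives a modulus of continuity valid for all representations. The
ultralimit is taken only of the span of the smoothed cocycles, where orbits are equicontinuous and
which is separable. Finally, the contracting function on `G/N` is replaced by finitely many point
masses, lifted to `G` and convolved with `φ`, so that the displacement becomes the norm of a finite
linear combination and passes to the limit. -/

/-! ### Averages against compactly supported functions -/

section Averages

variable {G : Type*} [Group G] [TopologicalSpace G] [IsTopologicalGroup G]
  [LocallyCompactSpace G]
variable {E : Type*} [NormedAddCommGroup E] [NormedSpace ℂ E]
variable {E' : Type*} [NormedAddCommGroup E'] [NormedSpace ℂ E']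

/-- The average `∫ f(g) ψ(g) dg` of a vector valued function. -/
noncomputable def avg (f : C_c(G, ℂ)) (ψ : G → E) : E := haarIntegral fun g => f g • ψ g

/-- The `L¹` norm of a compactly supported function. -/
noncomputable def normL1 (f : C_c(G, ℂ)) : ℝ := haarIntegral fun g => ‖f g‖

theorem normL1_nonneg (f : C_c(G, ℂ)) : 0 ≤ normL1 f := by
  borelize G
  exact integral_nonneg fun g => norm_nonneg _

theorem BanachRep.op_eq_avg (ρ : BanachRep G) (f : C_c(G, ℂ)) (x : ρ.E) :
    ρ.op f x = avg f fun g => ρ.toHom g x := rfl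

theorem avg_one (f : C_c(G, ℂ)) : avg f (fun _ => (1 : ℂ)) = haarIntegral fun g => f g := by
  simp [avg]

theorem avg_congr (f : C_c(G, ℂ)) {ψ χ : G → E} (h : ∀ g ∈ tsupport f, ψ g = χ g) :
    avg f ψ = avg f χ := by
  have e : (fun g => f g • ψ g) = fun g => f g • χ g := by
    ext g
    by_cases hg : g ∈ tsupport f
    · rw [h g hg]
    · simp [image_eq_zero_of_notMem_tsupport hg]
  simp only [avg, e]

theorem integrable_smul_haar [MeasurableSpace G] [BorelSpace G] (f : C_c(G, ℂ)) {ψ : G → E}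
    (hψ : Continuous ψ) : Integrable (fun g => f g • ψ g) (Measure.haar : Measure G) :=
  (f.continuous.smul hψ).integrable_of_hasCompactSupport
    (f.hasCompactSupport.smul_right (f' := ψ))

theorem avg_add (f : C_c(G, ℂ)) {ψ χ : G → E} (hψ : Continuous ψ) (hχ : Continuous χ) :
    avg f (fun g => ψ g + χ g) = avg f ψ + avg f χ := by
  borelize G
  simp only [avg, smul_add]
  exact integral_add (integrable_smul_haar f hψ) (integrable_smul_haar f hχ)

theorem avg_sub (f : C_c(G, ℂ)) {ψ χ : G → E} (hψ : Continuous ψ) (hχ : Continuous χ) :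
    avg f (fun g => ψ g - χ g) = avg f ψ - avg f χ := by
  borelize G
  simp only [avg, smul_sub]
  exact integral_sub (integrable_smul_haar f hψ) (integrable_smul_haar f hχ)

theorem avg_map [CompleteSpace E] [CompleteSpace E'] (f : C_c(G, ℂ)) (L : E →L[ℂ] E') {ψ : G → E}
    (hψ : Continuous ψ) : avg f (fun g => L (ψ g)) = L (avg f ψ) := by
  borelize G
  simp only [avg, ← map_smul]
  exact L.integral_comp_comm (integrable_smul_haar f hψ)

theorem avg_const [CompleteSpace E] (f : C_c(G, ℂ)) (x : E) :
    avg f (fun _ => x) = (haarIntegral fun g => f g) • x := by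
  borelize G
  exact integral_smul_const _ _

theorem norm_avg_le (f : C_c(G, ℂ)) {ψ : G → E} {C : ℝ}
    (hC : ∀ g ∈ tsupport f, ‖ψ g‖ ≤ C) : ‖avg f ψ‖ ≤ normL1 f * C := by
  borelize G
  have hint : Integrable (fun g => ‖f g‖) (Measure.haar : Measure G) :=
    (f.continuous.integrable_of_hasCompactSupport f.hasCompactSupport).norm
  have h : ‖∫ g, f g • ψ g ∂Measure.haar‖ ≤ ∫ g, ‖f g‖ * C ∂Measure.haar := by
    refine norm_integral_le_of_norm_le (hint.mul_const _) (Filter.Eventually.of_forall fun g => ?_)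
    by_cases hg : g ∈ tsupport f
    · rw [norm_smul]
      exact mul_le_mul_of_nonneg_left (hC g hg) (norm_nonneg _)
    · simp [image_eq_zero_of_notMem_tsupport hg]
  rwa [integral_mul_const] at h

theorem avg_sub_left (f k : C_c(G, ℂ)) {ψ : G → E} (hψ : Continuous ψ) :
    avg (f - k) ψ = avg f ψ - avg k ψ := by
  borelize G
  simp only [avg, CompactlySupportedContinuousMap.sub_apply, sub_smul]
  exact integral_sub (integrable_smul_haar f hψ) (integrable_smul_haar k hψ)

theorem avg_sum_smul_left {ι : Type*} (s : Finset ι) (c : ι → ℂ) (f : ι → C_c(G, ℂ)) {ψ : G → E}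
    (hψ : Continuous ψ) :
    avg (∑ i ∈ s, c i • f i) ψ = ∑ i ∈ s, c i • avg (f i) ψ := by
  borelize G
  simp only [avg, CompactlySupportedContinuousMap.sum_apply,
    CompactlySupportedContinuousMap.smul_apply, Finset.sum_smul, smul_assoc]
  refine (integral_finsetSum s fun i _ => ?_).trans ?_
  · exact (integrable_smul_haar (f i) hψ).smul (c i)
  · exact Finset.sum_congr rfl fun i _ => integral_smul _ _

/-- The left translate `h ↦ f (g⁻¹ h)`. -/
noncomputable def leftTranslate (g : G) (f : C_c(G, ℂ)) : C_c(G, ℂ) :=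
  f.comp (Homeomorph.mulLeft g⁻¹).toCocompactMap

theorem leftTranslate_apply {G : Type*} [Group G] [TopologicalSpace G] [IsTopologicalGroup G]
    (g : G) (f : C_c(G, ℂ)) (h : G) :
    leftTranslate g f h = f (g⁻¹ * h) := rfl

theorem avg_leftTranslate (g : G) (f : C_c(G, ℂ)) (ψ : G → E) :
    avg (leftTranslate g f) ψ = avg f fun h => ψ (g * h) := by
  borelize G
  have h := integral_mul_left_eq_self (μ := (Measure.haar : Measure G))
    (fun h => f (g⁻¹ * h) • ψ h) g
  simp only [inv_mul_cancel_left] at h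
  exact h.symm

theorem haarIntegral_eq_avg_one (f : C_c(G, ℂ)) :
    haarIntegral (fun g => f g) = avg f fun _ => (1 : ℂ) := (avg_one f).symm

theorem exists_haarIntegral_eq_one : ∃ f : C_c(G, ℂ), haarIntegral (fun g => f g) = 1 := by
  borelize G
  obtain ⟨f, hc, h0, h1⟩ := exists_continuous_nonneg_pos (1 : G)
  have hpos : 0 < ∫ g, f g ∂(Measure.haar : Measure G) :=
    f.continuous.integral_pos_of_hasCompactSupport_nonneg_nonzero hc h0 h1
  let F : C_c(G, ℂ) :=
    ⟨⟨fun g => ((∫ g, f g ∂(Measure.haar : Measure G) : ℝ) : ℂ)⁻¹ * (f g : ℂ), by fun_prop⟩,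
      (hc.comp_left (g := fun x : ℝ => (x : ℂ)) (by simp)).mul_left⟩
  refine ⟨F, ?_⟩
  change ∫ g, ((∫ g, f g ∂(Measure.haar : Measure G) : ℝ) : ℂ)⁻¹ * (f g : ℂ) ∂Measure.haar = 1
  rw [integral_const_mul, integral_complex_ofReal]
  exact inv_mul_cancel₀ (by exact_mod_cast hpos.ne')

end Averages

/-! ### Convolution, and uniform approximation of averages by finite sums -/

section Convolution

variable {G : Type*} [Group G] [TopologicalSpace G] [IsTopologicalGroup G]
  [LocallyCompactSpace G]
variable {E : Type*} [NormedAddCommGroup E] [NormedSpace ℂ E]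

/-- The convolution `(f * k)(g) = ∫ f(h) k(h⁻¹ g) dh` on `C_c(G)`. -/
noncomputable def convolve (f k : C_c(G, ℂ)) : C_c(G, ℂ) where
  toFun g := avg f fun h => k (h⁻¹ * g)
  continuous_toFun := by
    borelize G
    rw [← continuousOn_univ]
    refine continuousOn_integral_of_compact_support (f := fun g h => f h • k (h⁻¹ * g))
      f.hasCompactSupport.isCompact ?_ fun p x _ hx => ?_
    · refine Continuous.continuousOn ?_
      simp only [Function.uncurry_def]
      fun_prop
    · simp [image_eq_zero_of_notMem_tsupport hx]
  hasCompactSupport' := by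
    refine HasCompactSupport.intro
      (f.hasCompactSupport.isCompact.mul k.hasCompactSupport.isCompact) fun g hg => ?_
    have h0 : ∀ h, f h • k (h⁻¹ * g) = 0 := by
      intro h
      by_cases hf : h ∈ tsupport f
      · have : h⁻¹ * g ∉ tsupport k := fun hk =>
          hg ⟨h, hf, h⁻¹ * g, hk, by simp⟩
        simp [image_eq_zero_of_notMem_tsupport this]
      · simp [image_eq_zero_of_notMem_tsupport hf]
    borelize G
    simp only [avg, h0]
    exact integral_zero _ _

theorem avg_convolve [CompleteSpace E] (f k : C_c(G, ℂ)) {ψ : G → E} (hψ : Continuous ψ) :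
    avg (convolve f k) ψ = avg f fun h => avg k fun g => ψ (h * g) := by
  borelize G
  have e1 : ∀ g, convolve f k g • ψ g = ∫ h, (f h • k (h⁻¹ * g)) • ψ g ∂Measure.haar := fun g =>
    (integral_smul_const (μ := (Measure.haar : Measure G))
      (fun h => f h • k (h⁻¹ * g)) (ψ g)).symm
  have e2 : ∀ h, f h • avg k (fun g => ψ (h * g)) =
      ∫ g, (f h • k (h⁻¹ * g)) • ψ g ∂Measure.haar := by
    intro h
    rw [← avg_leftTranslate]
    simp only [smul_assoc]
    exact (integral_smul (μ := (Measure.haar : Measure G)) (f h)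
      (fun g => k (h⁻¹ * g) • ψ g)).symm
  change ∫ g, convolve f k g • ψ g ∂Measure.haar =
    ∫ h, f h • avg k (fun g => ψ (h * g)) ∂Measure.haar
  simp only [e1, e2]
  refine integral_integral_swap_of_hasCompactSupport
    (f := fun g h => (f h • k (h⁻¹ * g)) • ψ g) ?_ ?_
  · simp only [Function.uncurry_def]
    fun_prop
  · refine HasCompactSupport.intro
      ((f.hasCompactSupport.isCompact.mul k.hasCompactSupport.isCompact).prod
        f.hasCompactSupport.isCompact) ?_
    rintro ⟨g, h⟩ hg
    by_cases hf : h ∈ tsupport f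
    · have : h⁻¹ * g ∉ tsupport k := fun hk => hg ⟨⟨h, hf, h⁻¹ * g, hk, by simp⟩, hf⟩
      simp [image_eq_zero_of_notMem_tsupport this]
    · simp [image_eq_zero_of_notMem_tsupport hf]

theorem haarIntegral_convolve (f k : C_c(G, ℂ)) :
    haarIntegral (fun g => convolve f k g) =
      (haarIntegral fun g => f g) * haarIntegral fun g => k g := by
  rw [haarIntegral_eq_avg_one, avg_convolve f k continuous_const, avg_const, avg_one, smul_eq_mul]

/-- Powers of `ρ.op f` thus come from functions in `C_c(G)` that are the same for all `ρ`. -/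
theorem BanachRep.op_convolve (ρ : BanachRep G) (f k : C_c(G, ℂ)) :
    ρ.op (convolve f k) = ρ.op f * ρ.op k := by
  ext x
  change ρ.op (convolve f k) x = ρ.op f (ρ.op k x)
  rw [ρ.op_eq_avg, avg_convolve f k (ρ.continuous_orbit x), ρ.op_eq_avg]
  congr 1
  ext h
  rw [ρ.op_eq_avg, ← avg_map k (ρ.toHom h) (ρ.continuous_orbit x)]
  simp [map_mul]

/-- Averages of functions that oscillate little around the points of a compact set `Q` are close
to finite sums, with points and coefficients that do not depend on the function. -/
theorem exists_finset_approx_avg [T2Space G] {Q : Set G} (hQ : IsCompact Q) {W : G → Set G}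
    (hW : ∀ g ∈ Q, W g ∈ 𝓝 g) :
    ∃ (t : Finset G) (c : C_c(G, ℂ) → G → ℂ),
      (∀ f g, ‖c f g‖ ≤ normL1 f) ∧
      (∀ f : C_c(G, ℂ), tsupport f ⊆ Q → ∑ i ∈ t, c f i = haarIntegral fun g => f g) ∧
      ∀ (E : Type) [NormedAddCommGroup E] [NormedSpace ℂ E] [CompleteSpace E]
        (ψ : G → E) (η : ℝ), Continuous ψ → 0 ≤ η → (∀ i ∈ Q, ∀ g ∈ W i, ‖ψ g - ψ i‖ ≤ η) →
        ∀ f : C_c(G, ℂ), tsupport f ⊆ Q → ‖avg f ψ - ∑ i ∈ t, c f i • ψ i‖ ≤ normL1 f * η := by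
  classical
  borelize G
  obtain ⟨t, htQ, ht⟩ := hQ.elim_nhds_subcover (fun g => interior (W g))
    fun g hg => interior_mem_nhds.2 (hW g hg)
  let e := t.equivFin.symm
  obtain ⟨χ, hχs, hχ1, hχ01, -⟩ := exists_continuous_sum_one_of_isOpen_isCompact
    (s := fun i : Fin t.card => interior (W (e i))) (fun i => isOpen_interior) hQ (by
      intro g hg
      obtain ⟨i, hi, hgi⟩ := Set.mem_iUnion₂.1 (ht hg)
      exact Set.mem_iUnion.2 ⟨e.symm ⟨i, hi⟩, by simpa using hgi⟩)
  -- The partition of unity, reindexed by the points of `t` and extended by 0 to the other indices.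
  let X : G → G → ℂ := fun i g => if h : i ∈ t then (χ (e.symm ⟨i, h⟩) g : ℂ) else 0
  have hXcont : ∀ i, Continuous (X i) := by
    intro i
    by_cases h : i ∈ t <;> simp only [X, h, dite_true, dite_false] <;> fun_prop
  have hXnorm : ∀ i g, ‖X i g‖ ≤ 1 := by
    intro i g
    by_cases h : i ∈ t
    · simp only [X, h, dite_true, Complex.norm_real, Real.norm_eq_abs]
      exact abs_le.2 ⟨by linarith [(hχ01 (e.symm ⟨i, h⟩) g).1], (hχ01 _ g).2⟩
    · simp [X, h]
  have hXval : ∀ (i : t) g, X i g = (χ (e.symm i) g : ℂ) := by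
    intro i g
    simp [X]
  have hXsum : ∀ g ∈ Q, ∑ i ∈ t, X i g = 1 := by
    intro g hg
    have := hχ1 hg
    simp only [Finset.sum_apply, Pi.one_apply] at this
    rw [← Finset.sum_coe_sort t, ← Equiv.sum_comp e]
    simp only [hXval, Equiv.symm_apply_apply]
    exact_mod_cast this
  have hXsumnorm : ∀ g ∈ Q, ∑ i ∈ t, ‖X i g‖ = 1 := by
    intro g hg
    have := hχ1 hg
    simp only [Finset.sum_apply, Pi.one_apply] at this
    rw [← Finset.sum_coe_sort t, ← Equiv.sum_comp e, ← this]
    refine Finset.sum_congr rfl fun i _ => ?_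
    rw [hXval, Complex.norm_real, Real.norm_eq_abs, Equiv.symm_apply_apply,
      abs_of_nonneg (hχ01 _ g).1]
  have hXsupp : ∀ i ∈ t, ∀ g, X i g ≠ 0 → g ∈ W i := by
    intro i hi g hg
    have h1 : χ (e.symm ⟨i, hi⟩) g ≠ 0 := by
      simpa [hXval ⟨i, hi⟩ g] using hg
    have h2 := hχs _ (subset_tsupport _ h1)
    simp only [Equiv.apply_symm_apply] at h2
    exact interior_subset h2
  -- The weight of the point `i` is `∫ f χᵢ`, which involves neither `ψ` nor its target space.
  refine ⟨t, fun f i => avg f (X i), fun f i => ?_, fun f hf => ?_, ?_⟩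
  · simpa using norm_avg_le f (C := 1) fun g _ => hXnorm i g
  · have : ∑ i ∈ t, avg f (X i) = avg f fun g => ∑ i ∈ t, X i g :=
      (integral_finsetSum t fun i _ => integrable_smul_haar f (hXcont i)).symm.trans
        (by simp only [avg, Finset.smul_sum]; rfl)
    rw [this, haarIntegral_eq_avg_one]
    exact avg_congr f fun g hg => hXsum g (hf hg)
  · intro E _ _ _ ψ η hψ hη hosc f hf
    -- Since `∑ χᵢ = 1` on `Q`, the error is the average of `∑ χᵢ (ψ - ψ i)`, where `χᵢ` vanishes
    -- off `W i`.
    have e1 : avg f ψ - ∑ i ∈ t, avg f (X i) • ψ i =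
        avg f fun g => ∑ i ∈ t, X i g • (ψ g - ψ i) := by
      have h1 : ∀ i, avg f (X i) • ψ i = avg f fun g => X i g • ψ i := by
        intro i
        refine (integral_smul_const (μ := (Measure.haar : Measure G)) _ _).symm.trans ?_
        simp only [avg, smul_assoc]
        rfl
      have h2 : avg f ψ = avg f fun g => ∑ i ∈ t, X i g • ψ g := by
        refine avg_congr f fun g hg => ?_
        rw [← Finset.sum_smul, hXsum g (hf hg), one_smul]
      have h3 : ∑ i ∈ t, avg f (fun g => X i g • ψ i) = avg f fun g => ∑ i ∈ t, X i g • ψ i := by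
        refine (integral_finsetSum (μ := (Measure.haar : Measure G)) t fun i _ =>
          integrable_smul_haar f ((hXcont i).smul continuous_const)).symm.trans ?_
        simp only [avg, Finset.smul_sum]
        rfl
      simp only [h1]
      rw [h3, h2, ← avg_sub]
      · simp only [smul_sub, Finset.sum_sub_distrib]
      · exact continuous_finsetSum _ fun i _ => (hXcont i).smul hψ
      · exact continuous_finsetSum _ fun i _ => (hXcont i).smul continuous_const
    rw [e1]
    refine norm_avg_le f fun g hg => ?_
    calc ‖∑ i ∈ t, X i g • (ψ g - ψ i)‖ ≤ ∑ i ∈ t, ‖X i g‖ * η := by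
          refine norm_sum_le_of_le _ fun i hi => ?_
          rw [norm_smul]
          by_cases h0 : X i g = 0
          · simp [h0]
          · exact mul_le_mul_of_nonneg_left (hosc i (htQ i hi) g (hXsupp i hi g h0))
              (norm_nonneg _)
      _ = η := by rw [← Finset.sum_mul, hXsumnorm g (hf hg), one_mul]

end Convolution

/-! ### Pushing functions forward to a quotient group -/

section PushForward

variable {G : Type*} [Group G] [TopologicalSpace G] [IsTopologicalGroup G]
  [LocallyCompactSpace G] [T2Space G]

/-- Averages against `f ∈ C_c(G)` of functions that factor through `G ⧸ N` are averages
over `G ⧸ N`. -/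
theorem exists_avg_quotient (N : Subgroup G) [N.Normal] (hN : IsClosed (N : Set G))
    (f : C_c(G, ℂ)) :
    ∃ k : C_c(G ⧸ N, ℂ), ∀ (E : Type) [NormedAddCommGroup E] [NormedSpace ℂ E] [CompleteSpace E]
      (ψ : G ⧸ N → E), Continuous ψ → avg k ψ = avg f fun g => ψ (g : G ⧸ N) := by
  have : LocallyCompactSpace N := hN.isClosedEmbedding_subtypeVal.locallyCompactSpace
  borelize G
  let _ : MeasurableSpace N := borel N
  have _ : BorelSpace N := ⟨rfl⟩
  let _ : MeasurableSpace (G ⧸ N) := borel (G ⧸ N)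
  have _ : BorelSpace (G ⧸ N) := ⟨rfl⟩
  have H := TopologicalGroup.IsSES.ofClosedSubgroup N hN
  let μN : Measure N := Measure.haar
  let μ := H.inducedMeasure μN (Measure.haar : Measure (G ⧸ N))
  -- Uniqueness of Haar measure: `c` compares the chosen Haar measure of `G` with the one assembled
  -- from those of `N` and `G ⧸ N`.
  obtain ⟨c, hc⟩ := Measure.exists_integral_isMulLeftInvariant_eq_smul_of_hasCompactSupport
    (Measure.haar : Measure G) μ
  have hreal : ∀ u : C_c(G, ℝ), ∫ g, u g ∂(Measure.haar : Measure G) =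
      c * ∫ x, H.pushforward μN u x ∂Measure.haar := by
    intro u
    rw [hc u u.continuous u.hasCompactSupport, integral_smul_nnreal_measure]
    rw [H.integral_inducedMeasure, H.integrate_apply]
    rfl
  refine ⟨(c : ℂ) • H.pushforward μN f, ?_⟩
  intro E _ _ _ ψ hψ
  let v : C_c(G, E) := ⟨⟨fun g => f g • ψ (g : G ⧸ N), by fun_prop⟩,
    f.hasCompactSupport.smul_right (f' := fun g : G => ψ (g : G ⧸ N))⟩
  have hvint : Integrable v (Measure.haar : Measure G) :=
    v.continuous.integrable_of_hasCompactSupport v.hasCompactSupport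
  let w := H.pushforward μN v
  have hwint : Integrable w (Measure.haar : Measure (G ⧸ N)) :=
    w.continuous.integrable_of_hasCompactSupport w.hasCompactSupport
  -- The real-valued formula extends to `E`, whose points are separated by continuous real
  -- functionals.
  have key : ∫ g, v g ∂(Measure.haar : Measure G) = (c : ℝ) • ∫ x, w x ∂Measure.haar := by
    refine (SeparatingDual.eq_iff_forall_dual_eq (R := ℝ)).2 fun ℓ => ?_
    rw [map_smul, ← ℓ.integral_comp_comm hvint, ← ℓ.integral_comp_comm hwint, smul_eq_mul]
    let u : C_c(G, ℝ) := v.compLeft ⟨ℓ, ℓ.continuous⟩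
    have hu : ∀ g, u g = ℓ (v g) := fun g => by
      simp [u, CompactlySupportedContinuousMap.compLeft_apply]
    simp only [← hu]
    rw [hreal u]
    congr 2
    ext x
    obtain ⟨g, rfl⟩ := QuotientGroup.mk'_surjective N x
    rw [H.pushforward_apply_apply]
    change _ = ℓ (H.pushforward μN v _)
    rw [H.pushforward_apply_apply, ← ℓ.integral_comp_comm]
    · simp only [TopologicalGroup.IsSES.pullback_def, hu]
    · exact (H.pullback v g).continuous.integrable_of_hasCompactSupport
        (H.pullback v g).hasCompactSupport
  have hw : ∀ x, w x = H.pushforward μN f x • ψ x := by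
    intro x
    obtain ⟨g, rfl⟩ := QuotientGroup.mk'_surjective N x
    change H.pushforward μN v _ = _
    rw [H.pushforward_apply_apply, H.pushforward_apply_apply, ← integral_smul_const]
    congr 1
    ext n
    simp [TopologicalGroup.IsSES.pullback_def, v]
  change ∫ x, ((c : ℂ) • H.pushforward μN f) x • ψ x ∂Measure.haar =
    ∫ g, v g ∂(Measure.haar : Measure G)
  rw [key]
  simp only [hw, CompactlySupportedContinuousMap.smul_apply, smul_assoc]
  rw [integral_smul]
  simp

end PushForward

/-! ### Uniform bounds and equicontinuity over all representations -/

section Bounds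

variable {G : Type*} [Group G] [TopologicalSpace G]

open scoped Pointwise in
/-- Compact subsets are contained in a power of a compact symmetric generating set. -/
theorem IsCompact.exists_subset_pow [IsTopologicalGroup G] [LocallyCompactSpace G] [T2Space G]
    {S : Set G} (hS : IsCompact S) (hSsymm : ∀ g ∈ S, g⁻¹ ∈ S) (hSone : (1 : G) ∈ S)
    (hSgen : Subgroup.closure S = ⊤) {K : Set G} (hK : IsCompact K) : ∃ m : ℕ, K ⊆ S ^ m := by
  have hinv : S⁻¹ = S := by
    ext g
    exact ⟨fun h => by simpa using hSsymm _ h, fun h => hSsymm g h⟩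
  have hall : ∀ g : G, ∃ m : ℕ, g ∈ S ^ m := by
    intro g
    have hg : g ∈ Subgroup.closure S := hSgen ▸ Subgroup.mem_top g
    induction hg using Subgroup.closure_induction with
    | mem x hx => exact ⟨1, by simpa using hx⟩
    | one => exact ⟨0, by simp⟩
    | mul x y _ _ hx hy =>
      obtain ⟨m, hm⟩ := hx
      obtain ⟨k, hk⟩ := hy
      exact ⟨m + k, by rw [pow_add]; exact Set.mul_mem_mul hm hk⟩
    | inv x _ hx =>
      obtain ⟨m, hm⟩ := hx
      refine ⟨m, ?_⟩
      rw [← hinv, inv_pow]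
      exact Set.inv_mem_inv.2 hm
  have hcomp : ∀ m : ℕ, IsCompact (S ^ m) := by
    intro m
    induction m with
    | zero => simp
    | succ m ih => rw [pow_succ]; exact ih.mul hS
  -- Baire: some power of `S` has an interior point, and the translates of its interior are
  -- neighbourhoods contained in powers of `S`.
  obtain ⟨m₀, g₀, hg₀⟩ := nonempty_interior_of_iUnion_of_closed
    (fun m => (hcomp m).isClosed) (Set.eq_univ_of_forall fun g => Set.mem_iUnion.2 (hall g))
  have hmono : ∀ {m k : ℕ}, m ≤ k → S ^ m ⊆ S ^ k := fun h => Set.pow_subset_pow_right hSone h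
  refine hK.induction_on ⟨0, Set.empty_subset _⟩ (fun s t hst ⟨m, hm⟩ => ⟨m, hst.trans hm⟩)
    ?_ fun x _ => ?_
  · rintro s t ⟨m, hm⟩ ⟨k, hk⟩
    exact ⟨max m k, Set.union_subset (hm.trans (hmono (le_max_left _ _)))
      (hk.trans (hmono (le_max_right _ _)))⟩
  · obtain ⟨m, hm⟩ := hall (x * g₀⁻¹)
    refine ⟨(x * g₀⁻¹) • interior (S ^ m₀), mem_nhdsWithin_of_mem_nhds ?_, m + m₀, ?_⟩
    · refine (isOpen_interior.smul _).mem_nhds ⟨g₀, hg₀, by simp⟩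
    · rintro _ ⟨g, hg, rfl⟩
      rw [pow_add]
      exact Set.mul_mem_mul hm (interior_subset hg)

theorem BanachRep.cocycle_one {ρ : BanachRep G} {b : G → ρ.E} (hb : b ∈ ρ.Z1) : b 1 = 0 := by
  have := hb.2 1 1
  simpa using this

theorem BanachRep.norm_toHom_one_le (ρ : BanachRep G) : ‖ρ.toHom 1‖ ≤ 1 := by
  rw [map_one]
  exact ContinuousLinearMap.norm_id_le

-- Induction on word length: `b (g * s) = b g + π(g) (b s)` adds at most `M ^ m * D` when one letter
-- is appended. The bounds depend on `m` only, so they serve all representations at once.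
open scoped Pointwise in
theorem BddRep.norm_le_of_mem_pow {S : Set G} {M : ℝ} (hM : 1 ≤ M) (hSone : (1 : G) ∈ S)
    (ρ : BddRep S M) (m : ℕ) : ∀ g ∈ S ^ m, ‖ρ.1.toHom g‖ ≤ M ^ m ∧
      ∀ b ∈ ρ.1.Z1, ∀ D : ℝ, (∀ s ∈ S, ‖b s‖ ≤ D) → ‖b g‖ ≤ m * M ^ m * D := by
  induction m with
  | zero =>
    intro g hg
    obtain rfl : g = 1 := by simpa using hg
    refine ⟨by simpa using ρ.1.norm_toHom_one_le, fun b hb D _ => ?_⟩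
    simp [BanachRep.cocycle_one hb]
  | succ m ih =>
    intro g hg
    rw [pow_succ] at hg
    obtain ⟨g, hg, s, hs, rfl⟩ := hg
    obtain ⟨h1, h2⟩ := ih g hg
    have hMm : (0 : ℝ) ≤ M ^ m := by positivity
    refine ⟨?_, fun b hb D hD => ?_⟩
    · simp only [map_mul, pow_succ]
      exact (norm_mul_le _ _).trans (mul_le_mul h1 (ρ.2 s hs) (norm_nonneg _) hMm)
    · have hD0 : 0 ≤ D := (norm_nonneg _).trans (hD 1 hSone)
      simp only [hb.2 g s]
      calc ‖b g + ρ.1.toHom g (b s)‖ ≤ m * M ^ m * D + M ^ m * D := by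
            refine (norm_add_le _ _).trans (add_le_add (h2 b hb D hD) ?_)
            exact ((ρ.1.toHom g).le_opNorm _).trans
              (mul_le_mul h1 (hD s hs) (norm_nonneg _) hMm)
        _ = ((m : ℝ) + 1) * M ^ m * D := by ring
        _ ≤ ((m : ℝ) + 1) * M ^ (m + 1) * D := by
            have := pow_le_pow_right₀ hM (Nat.le_succ m)
            gcongr
        _ = _ := by push_cast; ring

/-- Representations bounded on `S`, and cocycles, are uniformly bounded on compact sets. -/
theorem BddRep.exists_bound [IsTopologicalGroup G] [LocallyCompactSpace G] [T2Space G]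
    {S : Set G} (hS : IsCompact S) (hSsymm : ∀ g ∈ S, g⁻¹ ∈ S) (hSone : (1 : G) ∈ S)
    (hSgen : Subgroup.closure S = ⊤) {M : ℝ} (hM : 1 ≤ M) {K : Set G} (hK : IsCompact K) :
    ∃ C : ℝ, 0 ≤ C ∧ ∀ ρ : BddRep S M, ∀ g ∈ K, ‖ρ.1.toHom g‖ ≤ C ∧
      ∀ b ∈ ρ.1.Z1, ∀ D : ℝ, (∀ s ∈ S, ‖b s‖ ≤ D) → ‖b g‖ ≤ C * D := by
  obtain ⟨m, hm⟩ := hS.exists_subset_pow hSsymm hSone hSgen hK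
  have hM0 : (0 : ℝ) ≤ M ^ m := by positivity
  refine ⟨(m + 1) * M ^ m, by positivity, fun ρ g hg => ?_⟩
  obtain ⟨h1, h2⟩ := ρ.norm_le_of_mem_pow hM hSone m g (hm hg)
  refine ⟨h1.trans ?_, fun b hb D hD => (h2 b hb D hD).trans ?_⟩
  · have : 0 ≤ (m : ℝ) * M ^ m := by positivity
    linarith
  · have hD0 : 0 ≤ D := (norm_nonneg _).trans (hD 1 hSone)
    have : 0 ≤ M ^ m * D := by positivity
    linarith

/-- Averaging makes cocycles equicontinuous, uniformly over all representations. -/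
theorem BddRep.eventually_norm_avg_cocycle_le [IsTopologicalGroup G] [LocallyCompactSpace G]
    [T2Space G] {S : Set G} (hS : IsCompact S) (hSsymm : ∀ g ∈ S, g⁻¹ ∈ S) (hSone : (1 : G) ∈ S)
    (hSgen : Subgroup.closure S = ⊤) {M : ℝ} (hM : 1 ≤ M) (φ : C_c(G, ℂ)) (g₀ : G) {η : ℝ}
    (hη : 0 < η) :
    ∀ᶠ g in 𝓝 g₀, ∀ ρ : BddRep S M, ∀ b ∈ ρ.1.Z1, (∀ s ∈ S, ‖b s‖ ≤ 1) →
      ‖avg φ (fun h => b (g * h)) - avg φ (fun h => b (g₀ * h))‖ ≤ η := by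
  obtain ⟨K, hK, hKg⟩ := exists_compact_mem_nhds g₀
  let K' : Set G := (fun p : G × G => p.1 * p.2) '' (K ×ˢ tsupport φ)
  have hK' : IsCompact K' :=
    (hK.prod φ.hasCompactSupport.isCompact).image continuous_mul
  have hvan : ∀ g ∈ K, ∀ h, h ∉ K' → φ (g⁻¹ * h) = 0 := by
    intro g hg h hh
    refine image_eq_zero_of_notMem_tsupport fun h' => hh ⟨(g, g⁻¹ * h), ⟨hg, h'⟩, ?_⟩
    simp
  obtain ⟨C, hC0, hC⟩ := BddRep.exists_bound hS hSsymm hSone hSgen hM hK'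
  -- The `L¹` distance between two translates of `φ`. For `g` in `K` these all live in `K'`, and the
  -- cocycle enters only through its bound on `K'`, whence the uniformity.
  let F : G → ℝ := fun g => normL1 (leftTranslate g φ - leftTranslate g₀ φ)
  have hF : ContinuousOn F K := by
    borelize G
    refine continuousOn_integral_of_compact_support
      (f := fun g h => ‖φ (g⁻¹ * h) - φ (g₀⁻¹ * h)‖) hK' ?_ fun g h hg hh => ?_
    · refine Continuous.continuousOn ?_
      simp only [Function.uncurry_def]
      fun_prop
    · simp [hvan g hg h hh, hvan g₀ (mem_of_mem_nhds hKg) h hh]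
  have hF0 : F g₀ = 0 := by
    borelize G
    simp only [F, sub_self]
    change ∫ g, ‖(0 : C_c(G, ℂ)) g‖ ∂Measure.haar = 0
    simp
  have hlim : Filter.Tendsto (fun g => F g * C) (𝓝 g₀) (𝓝 0) := by
    have := ((hF.continuousAt hKg).tendsto).mul_const C
    simpa [hF0] using this
  filter_upwards [hlim.eventually_lt_const hη, hKg] with g hg hgK ρ b hb hb1
  rw [← avg_leftTranslate, ← avg_leftTranslate, ← avg_sub_left _ _ hb.1]
  refine (norm_avg_le _ fun h hh => ?_).trans hg.le
  have hh' : h ∈ K' := by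
    refine closure_minimal (fun x hx => ?_) hK'.isClosed hh
    by_contra hx'
    refine hx ?_
    simp [leftTranslate_apply, hvan g hgK x hx', hvan g₀ (mem_of_mem_nhds hKg) x hx']
  simpa using (hC ρ h hh').2 b hb 1 hb1

end Bounds

/-! ### Ultralimits of representations -/

section UltraNorm

variable {E : ℕ → Type} [∀ n, NormedAddCommGroup (E n)]

/-- The limit of the norms of a sequence of vectors along an ultrafilter. -/
noncomputable def ultraNorm (U : Ultrafilter ℕ) (v : ∀ n, E n) : ℝ :=
  Filter.limUnder (U : Filter ℕ) fun n => ‖v n‖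

/-- The interval `[0, C]` is compact, so the limit defining `ultraNorm` exists for bounded
sequences. -/
theorem tendsto_ultraNorm (U : Ultrafilter ℕ) {v : ∀ n, E n} (hv : ∃ C, ∀ n, ‖v n‖ ≤ C) :
    Filter.Tendsto (fun n => ‖v n‖) U (𝓝 (ultraNorm U v)) := by
  obtain ⟨C, hC⟩ := hv
  refine tendsto_nhds_limUnder ?_
  obtain ⟨x, -, hx⟩ := (isCompact_Icc (a := (0 : ℝ)) (b := C)).ultrafilter_le_nhds'
    (U.map fun n => ‖v n‖) (Filter.Eventually.of_forall (f := (U : Filter ℕ))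
      fun n => ⟨norm_nonneg (v n), hC n⟩)
  exact ⟨x, hx⟩

variable [∀ n, NormedSpace ℂ (E n)]

/-- A space of bounded sequences of vectors, with the limit of the norms as seminorm. -/
def UltraSpace (V : Submodule ℂ (∀ n, E n)) (_ : ∀ v ∈ V, ∃ C, ∀ n, ‖v n‖ ≤ C)
    (_ : Ultrafilter ℕ) : Type := V

variable (V : Submodule ℂ (∀ n, E n)) (hV : ∀ v ∈ V, ∃ C, ∀ n, ‖v n‖ ≤ C) (U : Ultrafilter ℕ)

instance : AddCommGroup (UltraSpace V hV U) := inferInstanceAs (AddCommGroup V)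

instance : Module ℂ (UltraSpace V hV U) := inferInstanceAs (Module ℂ V)

/-- The identity, from a space of sequences to the same space with its limit seminorm. -/
def toUltraSpace : V ≃ₗ[ℂ] UltraSpace V hV U := LinearEquiv.refl ℂ V

/-- The limit of the norms, as a seminorm. -/
noncomputable def ultraSeminorm : AddGroupSeminorm (UltraSpace V hV U) where
  toFun v := ultraNorm U ((toUltraSpace V hV U).symm v).1
  map_zero' := tendsto_nhds_unique (tendsto_ultraNorm U (hV _ (Subtype.prop _)))
    (by simp)
  add_le' v w := by
    have h1 := tendsto_ultraNorm U (hV _ ((toUltraSpace V hV U).symm v).2)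
    have h2 := tendsto_ultraNorm U (hV _ ((toUltraSpace V hV U).symm w).2)
    refine le_of_tendsto_of_tendsto
      (tendsto_ultraNorm U (hV _ ((toUltraSpace V hV U).symm (v + w)).2)) (h1.add h2)
      (Filter.Eventually.of_forall fun n => ?_)
    simpa using norm_add_le _ _
  neg' v := by
    simp [ultraNorm]

noncomputable instance : SeminormedAddCommGroup (UltraSpace V hV U) :=
  (ultraSeminorm V hV U).toSeminormedAddCommGroup

theorem tendsto_norm_toUltraSpace (v : V) :
    Filter.Tendsto (fun n => ‖v.1 n‖) U (𝓝 ‖toUltraSpace V hV U v‖) :=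
  tendsto_ultraNorm U (hV v.1 v.2)

noncomputable instance : NormedSpace ℂ (UltraSpace V hV U) where
  norm_smul_le c v := by
    obtain ⟨v, rfl⟩ := (toUltraSpace V hV U).surjective v
    have h1 := tendsto_norm_toUltraSpace V hV U (c • v)
    have h2 := (tendsto_norm_toUltraSpace V hV U v).const_mul ‖c‖
    rw [← map_smul]
    refine (tendsto_nhds_unique h1 ?_).le
    simpa [norm_smul] using h2

end UltraNorm

section UltraLimit

variable {G : Type*} [Group G] [TopologicalSpace G]
variable {ρ : ℕ → BanachRep G} {x : G → ∀ n, (ρ n).E}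

theorem bounded_of_mem_span (hxb : ∀ g, ∃ C, ∀ n, ‖x g n‖ ≤ C) :
    ∀ v ∈ Submodule.span ℂ (Set.range x), ∃ C, ∀ n, ‖v n‖ ≤ C := by
  intro v hv
  induction hv using Submodule.span_induction with
  | mem v h => obtain ⟨g, rfl⟩ := h; exact hxb g
  | zero => exact ⟨0, by simp⟩
  | add v w _ _ h1 h2 =>
    obtain ⟨C, hC⟩ := h1
    obtain ⟨D, hD⟩ := h2
    exact ⟨C + D, fun n => (norm_add_le _ _).trans (add_le_add (hC n) (hD n))⟩
  | smul c v _ h =>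
    obtain ⟨C, hC⟩ := h
    refine ⟨‖c‖ * C, fun n => ?_⟩
    rw [Pi.smul_apply, norm_smul]
    exact mul_le_mul_of_nonneg_left (hC n) (norm_nonneg _)

/-- The cocycle relation reads `π(g) x(h) = x(gh) - x(g)`, so the values of a cocycle span an
invariant subspace. -/
theorem toHom_mem_span (hx : ∀ n, (fun g => x g n) ∈ (ρ n).Z1) (g : G) :
    ∀ v ∈ Submodule.span ℂ (Set.range x),
      (fun n => (ρ n).toHom g (v n)) ∈ Submodule.span ℂ (Set.range x) := by
  intro v hv
  induction hv using Submodule.span_induction with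
  | mem v h =>
    obtain ⟨h, rfl⟩ := h
    have : (fun n => (ρ n).toHom g (x h n)) = x (g * h) - x g := by
      ext n
      have := (hx n).2 g h
      simp only at this
      simp [this]
    rw [this]
    exact sub_mem (Submodule.subset_span ⟨_, rfl⟩) (Submodule.subset_span ⟨_, rfl⟩)
  | zero => simp only [Pi.zero_apply, map_zero]; exact Submodule.zero_mem _
  | add v w _ _ h1 h2 =>
    simp only [Pi.add_apply, map_add]
    exact Submodule.add_mem _ h1 h2
  | smul c v _ h =>
    simp only [Pi.smul_apply, map_smul]
    exact Submodule.smul_mem _ c h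

/-- On generators `π(g)x(h) - π(g₀)x(h) = (x(gh) - x(g₀h)) - (x(g) - x(g₀))`: equicontinuity of the
cocycles alone controls the orbits of all vectors of the span. -/
theorem equicontinuous_of_mem_span [IsTopologicalGroup G]
    (hx : ∀ n, (fun g => x g n) ∈ (ρ n).Z1)
    (heq : ∀ g₀, ∀ η > 0, ∀ᶠ g in 𝓝 g₀, ∀ n, ‖x g n - x g₀ n‖ ≤ η) :
    ∀ v ∈ Submodule.span ℂ (Set.range x), ∀ g₀, ∀ η > 0,
      ∀ᶠ g in 𝓝 g₀, ∀ n, ‖(ρ n).toHom g (v n) - (ρ n).toHom g₀ (v n)‖ ≤ η := by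
  intro v hv g₀
  induction hv using Submodule.span_induction with
  | mem v h =>
    intro η hη
    obtain ⟨h, rfl⟩ := h
    have h1 := ((continuous_mul_const h).tendsto g₀).eventually (heq (g₀ * h) (η / 2) (half_pos hη))
    filter_upwards [h1, heq g₀ (η / 2) (half_pos hη)] with g h1 h2 n
    have e : (ρ n).toHom g (x h n) - (ρ n).toHom g₀ (x h n) =
        (x (g * h) n - x (g₀ * h) n) - (x g n - x g₀ n) := by
      have e1 := (hx n).2 g h
      have e2 := (hx n).2 g₀ h
      simp only at e1 e2
      rw [e1, e2]
      abel
    rw [e]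
    exact (norm_sub_le _ _).trans (by linarith [h1 n, h2 n])
  | zero => intro η hη; simp [hη.le]
  | add v w _ _ h1 h2 =>
    intro η hη
    filter_upwards [h1 (η / 2) (half_pos hη), h2 (η / 2) (half_pos hη)] with g h1 h2 n
    have e : (ρ n).toHom g ((v + w) n) - (ρ n).toHom g₀ ((v + w) n) =
        ((ρ n).toHom g (v n) - (ρ n).toHom g₀ (v n)) +
          ((ρ n).toHom g (w n) - (ρ n).toHom g₀ (w n)) := by
      simp only [Pi.add_apply, map_add]
      abel
    rw [e]
    exact (norm_add_le _ _).trans (by linarith [h1 n, h2 n])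
  | smul c v _ h =>
    intro η hη
    have hpos : 0 < ‖c‖ + 1 := by positivity
    filter_upwards [h (η / (‖c‖ + 1)) (by positivity)] with g h n
    rw [Pi.smul_apply, map_smul, map_smul, ← smul_sub, norm_smul]
    calc ‖c‖ * _ ≤ (‖c‖ + 1) * (η / (‖c‖ + 1)) :=
          mul_le_mul (by linarith) (h n) (norm_nonneg _) hpos.le
      _ = η := by field_simp

/-- A sequence of representations with bounded equicontinuous cocycles has a limit along every
ultrafilter, which is spanned by the limit of the cocycles. -/
theorem exists_ultralimit [IsTopologicalGroup G] [TopologicalSpace.SeparableSpace G]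
    (U : Ultrafilter ℕ)
    (hx : ∀ n, (fun g => x g n) ∈ (ρ n).Z1) (hxb : ∀ g, ∃ C, ∀ n, ‖x g n‖ ≤ C)
    (hρ : ∀ g₀, ∃ C, ∀ᶠ g in 𝓝 g₀, ∀ n, ‖(ρ n).toHom g‖ ≤ C)
    (heq : ∀ g₀, ∀ η > 0, ∀ᶠ g in 𝓝 g₀, ∀ n, ‖x g n - x g₀ n‖ ≤ η) :
    ∃ (L : BanachRep G) (j : Submodule.span ℂ (Set.range x) →ₗ[ℂ] L.E), DenseRange j ∧
      (∀ v, Filter.Tendsto (fun n => ‖v.1 n‖) U (𝓝 ‖j v‖)) ∧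
      ∀ g v w, (∀ n, w.1 n = (ρ n).toHom g (v.1 n)) → L.toHom g (j v) = j w := by
  let V := Submodule.span ℂ (Set.range x)
  have hV := bounded_of_mem_span hxb
  let P := UltraSpace V hV U
  let ι := toUltraSpace V hV U
  have hι := tendsto_norm_toUltraSpace V hV U
  have hbound : ∀ g, ∃ C, 0 ≤ C ∧ ∀ n, ‖(ρ n).toHom g‖ ≤ C := by
    intro g
    obtain ⟨C, hC⟩ := hρ g
    exact ⟨C, (norm_nonneg _).trans (hC.self_of_nhds 0), hC.self_of_nhds⟩
  have hact : ∀ g (v w : V) C, (∀ n, ‖(ρ n).toHom g‖ ≤ C) →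
      (∀ n, w.1 n = (ρ n).toHom g (v.1 n)) → ‖ι w‖ ≤ C * ‖ι v‖ := by
    intro g v w C hC hw
    refine le_of_tendsto_of_tendsto (hι w) ((hι v).const_mul C)
      (Filter.Eventually.of_forall fun n => ?_)
    simp only [hw n]
    exact ((ρ n).toHom g).le_of_opNorm_le (hC n) _
  let A : G → V →ₗ[ℂ] V := fun g =>
    { toFun := fun v => ⟨fun n => (ρ n).toHom g (v.1 n), toHom_mem_span hx g v.1 v.2⟩
      map_add' := fun v w => by ext n; simp
      map_smul' := fun c v => by ext n; simp }
  have hA : ∀ g v n, (A g v).1 n = (ρ n).toHom g (v.1 n) := fun g v n => rfl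
  let T : G → P →L[ℂ] P := fun g => LinearMap.mkContinuousOfExistsBound
    (ι.toLinearMap ∘ₗ A g ∘ₗ ι.symm.toLinearMap) (by
      obtain ⟨C, -, hC⟩ := hbound g
      refine ⟨C, fun p => ?_⟩
      exact hact g (ι.symm p) (A g (ι.symm p)) C hC (hA g _))
  have hT : ∀ g v, T g (ι v) = ι (A g v) := fun g v => rfl
  have hTnorm : ∀ g C, (∀ n, ‖(ρ n).toHom g‖ ≤ C) →
      ∀ y : UniformSpace.Completion P, ‖(T g).completion y‖ ≤ C * ‖y‖ := by
    intro g C hC y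
    induction y using UniformSpace.Completion.induction_on with
    | hp => exact isClosed_le (by fun_prop) (by fun_prop)
    | ih p =>
      obtain ⟨v, rfl⟩ := ι.surjective p
      rw [ContinuousLinearMap.completion_apply_coe, UniformSpace.Completion.norm_coe,
        UniformSpace.Completion.norm_coe, hT]
      exact hact g v (A g v) C hC (hA g v)
  have hcontV : ∀ (v : V) g₀, ∀ η > 0, ∀ᶠ g in 𝓝 g₀, ‖T g (ι v) - T g₀ (ι v)‖ ≤ η := by
    intro v g₀ η hη
    filter_upwards [equicontinuous_of_mem_span hx heq v.1 v.2 g₀ η hη] with g hg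
    rw [hT, hT, ← map_sub]
    exact le_of_tendsto (hι _) (Filter.Eventually.of_forall hg)
  have hdense : DenseRange ((↑) : P → UniformSpace.Completion P) :=
    UniformSpace.Completion.denseRange_coe
  -- `P` is spanned by the image of the separable group `G` under the limit cocycle, which is
  -- continuous by `heq`.
  have hsep : TopologicalSpace.SeparableSpace P := by
    let y : G → P := fun g => ι ⟨x g, Submodule.subset_span ⟨g, rfl⟩⟩
    have hy : Continuous y := by
      rw [Metric.continuous_iff']
      intro g₀ ε hε
      filter_upwards [heq g₀ (ε / 2) (half_pos hε)] with g hg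
      rw [dist_eq_norm]
      refine lt_of_le_of_lt ?_ (half_lt_self hε)
      simp only [y, ← map_sub]
      exact le_of_tendsto (hι _) (Filter.Eventually.of_forall hg)
    have hspan := (TopologicalSpace.isSeparable_range hy).span (R := ℂ)
    rw [← TopologicalSpace.isSeparable_univ_iff]
    refine hspan.mono fun p _ => ?_
    obtain ⟨⟨v, hv⟩, rfl⟩ := ι.surjective p
    have key : ∀ v (hv : v ∈ V), ι ⟨v, hv⟩ ∈ Submodule.span ℂ (Set.range y) := by
      intro v hv
      induction hv using Submodule.span_induction with
      | mem v h => obtain ⟨g, rfl⟩ := h; exact Submodule.subset_span ⟨g, rfl⟩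
      | zero => exact Submodule.zero_mem _
      | add v w hv hw h1 h2 => exact Submodule.add_mem _ h1 h2
      | smul c v hv h => exact Submodule.smul_mem _ c h
    exact key v hv
  let L : BanachRep G :=
    { E := UniformSpace.Completion P
      toHom :=
        { toFun := fun g => (T g).completion
          map_one' := by
            ext y
            induction y using UniformSpace.Completion.induction_on with
            | hp => exact isClosed_eq (by fun_prop) (by fun_prop)
            | ih p =>
              obtain ⟨v, rfl⟩ := ι.surjective p
              rw [ContinuousLinearMap.completion_apply_coe, hT]
              have : A 1 v = v := by ext n; simp [hA]
              rw [this]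
              rfl
          map_mul' := fun g h => by
            ext y
            induction y using UniformSpace.Completion.induction_on with
            | hp => exact isClosed_eq (by fun_prop) (by fun_prop)
            | ih p =>
              obtain ⟨v, rfl⟩ := ι.surjective p
              rw [ContinuousLinearMap.completion_apply_coe, hT, mul_apply_eq_comp,
                ContinuousLinearMap.completion_apply_coe, hT,
                ContinuousLinearMap.completion_apply_coe, hT]
              have : A (g * h) v = A g (A h v) := by ext n; simp [hA]
              rw [this] }
      continuous_orbit := by
        intro y
        rw [Metric.continuous_iff']
        intro g₀ ε hε
        obtain ⟨C, hC⟩ := hρ g₀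
        have hC0 : 0 ≤ C := (norm_nonneg _).trans (hC.self_of_nhds 0)
        -- The local bound `C` reduces continuity on the completion to vectors of `P`; the three
        -- resulting errors are at most `ε / 4` each.
        obtain ⟨p, hp⟩ := hdense.exists_dist_lt y (ε := ε / (4 * (C + 1))) (by positivity)
        obtain ⟨v, rfl⟩ := ι.surjective p
        filter_upwards [hC, hcontV v g₀ (ε / 4) (by positivity)] with g hg hgv
        have e1 := hTnorm g C hg (y - (ι v : P))
        have e2 := hTnorm g₀ C hC.self_of_nhds (y - (ι v : P))
        rw [dist_eq_norm] at hp
        have e3 : C * ‖y - (ι v : P)‖ ≤ ε / 4 := by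
          calc C * ‖y - (ι v : P)‖ ≤ (C + 1) * (ε / (4 * (C + 1))) :=
                mul_le_mul (by linarith) hp.le (norm_nonneg _) (by linarith)
            _ = ε / 4 := by field_simp
        have e4 : ‖(T g).completion (ι v : P) - (T g₀).completion (ι v : P)‖ ≤ ε / 4 := by
          rw [ContinuousLinearMap.completion_apply_coe, ContinuousLinearMap.completion_apply_coe,
            ← UniformSpace.Completion.coe_sub, UniformSpace.Completion.norm_coe]
          exact hgv
        rw [dist_eq_norm]
        change ‖(T g).completion y - (T g₀).completion y‖ < ε
        have e5 : (T g).completion y - (T g₀).completion y =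
            (T g).completion (y - (ι v : P)) - (T g₀).completion (y - (ι v : P)) +
              ((T g).completion (ι v : P) - (T g₀).completion (ι v : P)) := by
          simp only [map_sub]
          abel
        rw [e5]
        have e6 := norm_add_le ((T g).completion (y - (ι v : P)) -
          (T g₀).completion (y - (ι v : P)))
          ((T g).completion (ι v : P) - (T g₀).completion (ι v : P))
        have e7 := norm_sub_le ((T g).completion (y - (ι v : P)))
          ((T g₀).completion (y - (ι v : P)))
        linarith }
  refine ⟨L, (UniformSpace.Completion.toComplL (𝕜 := ℂ) (E := P)).toLinearMap ∘ₗ ι.toLinearMap,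
    ?_, ?_, ?_⟩
  · exact hdense.comp ι.surjective.denseRange
      (UniformSpace.Completion.continuous_coe P)
  · intro v
    have := hι v
    rwa [← UniformSpace.Completion.norm_coe] at this
  · intro g v w hw
    have : A g v = w := by ext n; rw [hA, hw]
    rw [← this]
    exact ContinuousLinearMap.completion_apply_coe (T g) (ι v)

end UltraLimit

/-! ### Closed families contain their ultralimits -/

section ClosedUnderLimits

theorem tendsto_norm_sum_sub {E : ℕ → Type} [∀ n, NormedAddCommGroup (E n)]
    [∀ n, NormedSpace ℂ (E n)] {ι : Type*} [Fintype ι] (U : Filter ℕ)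
    {w : ι → ∀ n, E n} (hw : ∀ i, ∃ C, ∀ n, ‖w i n‖ ≤ C) {c : ℕ → ι → ℂ} {c₀ : ι → ℂ}
    (hc : Filter.Tendsto c U (𝓝 c₀)) :
    Filter.Tendsto (fun n => ‖∑ i, c n i • w i n‖ - ‖∑ i, c₀ i • w i n‖) U (𝓝 0) := by
  choose C hC using hw
  have h0 : Filter.Tendsto (fun n => ∑ i, ‖c n i - c₀ i‖ * C i) U (𝓝 0) := by
    have : Filter.Tendsto (fun n => ∑ i, ‖c n i - c₀ i‖ * C i) U
        (𝓝 (∑ i, ‖c₀ i - c₀ i‖ * C i)) := by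
      refine tendsto_finsetSum _ fun i _ => ?_
      exact (((tendsto_pi_nhds.1 hc i).sub_const _).norm).mul_const _
    simpa using this
  refine squeeze_zero_norm (fun n => ?_) h0
  rw [Real.norm_eq_abs]
  refine (abs_norm_sub_norm_le _ _).trans ?_
  rw [← Finset.sum_sub_distrib]
  refine norm_sum_le_of_le _ fun i _ => ?_
  rw [← sub_smul, norm_smul]
  exact mul_le_mul_of_nonneg_left (hC i n) (norm_nonneg _)

/-- Norms of linear combinations of finitely many vectors converge uniformly in the
coefficients. -/
theorem eventually_abs_norm_sum_sub_le {E : ℕ → Type} [∀ n, NormedAddCommGroup (E n)]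
    [∀ n, NormedSpace ℂ (E n)] {X : Type} [NormedAddCommGroup X] [NormedSpace ℂ X]
    {ι : Type*} [Fintype ι] (U : Ultrafilter ℕ) {V : Submodule ℂ (∀ n, E n)}
    (hV : ∀ v ∈ V, ∃ C, ∀ n, ‖v n‖ ≤ C) (j : V →ₗ[ℂ] X)
    (hj : ∀ v, Filter.Tendsto (fun n => ‖v.1 n‖) U (𝓝 ‖j v‖)) (w : ι → V) {η : ℝ} (hη : 0 < η) :
    ∀ᶠ n in (U : Filter ℕ), ∀ c : ι → ℂ, (∀ i, ‖c i‖ ≤ 1) →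
      |‖∑ i, c i • (w i).1 n‖ - ‖∑ i, c i • j (w i)‖| ≤ η := by
  by_contra hcon
  rw [← Ultrafilter.eventually_not] at hcon
  -- `c n` is a bad choice of coefficients if there is one, and 0 otherwise. By compactness of the
  -- polydisc it converges along `U` to some `c₀`, and for the fixed coefficients `c₀` the norms
  -- converge by `hj`.
  have hex : ∀ n, ∃ c : ι → ℂ, (∀ i, ‖c i‖ ≤ 1) ∧
      ((¬ ∀ c : ι → ℂ, (∀ i, ‖c i‖ ≤ 1) →
        |‖∑ i, c i • (w i).1 n‖ - ‖∑ i, c i • j (w i)‖| ≤ η) →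
        η < |‖∑ i, c i • (w i).1 n‖ - ‖∑ i, c i • j (w i)‖|) := by
    intro n
    by_cases h : ∀ c : ι → ℂ, (∀ i, ‖c i‖ ≤ 1) →
        |‖∑ i, c i • (w i).1 n‖ - ‖∑ i, c i • j (w i)‖| ≤ η
    · exact ⟨0, by simp, fun h' => absurd h h'⟩
    · have h' := h
      push Not at h'
      obtain ⟨c, hc, hc'⟩ := h'
      exact ⟨c, hc, fun _ => hc'⟩
  choose c hc1 hc2 using hex
  obtain ⟨c₀, -, hc₀⟩ := (isCompact_univ_pi fun _ : ι =>
    isCompact_closedBall (0 : ℂ) 1).ultrafilter_le_nhds' (U.map c)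
    (Filter.Eventually.of_forall (f := (U : Filter ℕ))
      fun n i _ => by simpa using hc1 n i)
  have hlim : Filter.Tendsto c U (𝓝 c₀) := hc₀
  have h1 := tendsto_norm_sum_sub U (w := fun i => (w i).1) (fun i => hV _ (w i).2) hlim
  have h2 := tendsto_norm_sum_sub (E := fun _ => X) U (w := fun i _ => j (w i))
    (fun i => ⟨_, fun _ => le_rfl⟩) hlim
  have h3 := hj (∑ i, c₀ i • w i)
  have h4 : Filter.Tendsto
      (fun n => ‖∑ i, c n i • (w i).1 n‖ - ‖∑ i, c n i • j (w i)‖) U (𝓝 0) := by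
    have := (h1.sub h2).add (h3.sub_const ‖j (∑ i, c₀ i • w i)‖)
    simp only [sub_self, add_zero] at this
    refine this.congr fun n => ?_
    simp only [map_sum, map_smul, Submodule.coe_sum, Submodule.coe_smul, Finset.sum_apply,
      Pi.smul_apply]
    ring
  have h5 := (h4.abs).eventually_lt_const (by simpa using hη)
  obtain ⟨n, hn1, hn2⟩ := (hcon.and h5).exists
  exact absurd (hc2 n hn1) (not_lt.2 hn2.le)

variable {G : Type*} [Group G] [TopologicalSpace G] [IsTopologicalGroup G]
  [LocallyCompactSpace G]

theorem BddRep.norm_op_le {S : Set G} {M : ℝ} {Q : Set G} {C : ℝ} (ρ : BddRep S M)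
    (hC : ∀ g ∈ Q, ‖ρ.1.toHom g‖ ≤ C) {f : C_c(G, ℂ)} (hf : tsupport f ⊆ Q) (x : ρ.1.E) :
    ‖ρ.1.op f x‖ ≤ normL1 f * (C * ‖x‖) :=
  norm_avg_le f fun g hg => (ρ.1.toHom g).le_of_opNorm_le (hC g (hf hg)) x

/-- Any configuration of vectors of an ultralimit of representations is approximated, in the
sense of the sets `basicNhd`, by vectors of the representations of the sequence. -/
theorem BddRep.eventually_exists_approx [T2Space G] {S : Set G} (hS : IsCompact S)
    (hSsymm : ∀ g ∈ S, g⁻¹ ∈ S) (hSone : (1 : G) ∈ S) (hSgen : Subgroup.closure S = ⊤) {M : ℝ}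
    (hM : 1 ≤ M) (U : Ultrafilter ℕ) {ρ : ℕ → BddRep S M} {V : Submodule ℂ (∀ n, (ρ n).1.E)}
    (hV : ∀ v ∈ V, ∃ C, ∀ n, ‖v n‖ ≤ C)
    (hVinv : ∀ g, ∀ v ∈ V, (fun n => (ρ n).1.toHom g (v n)) ∈ V)
    (hVeq : ∀ v ∈ V, ∀ g₀, ∀ η > 0,
      ∀ᶠ g in 𝓝 g₀, ∀ n, ‖(ρ n).1.toHom g (v n) - (ρ n).1.toHom g₀ (v n)‖ ≤ η)
    {L : BddRep S M} (j : V →ₗ[ℂ] L.1.E) (hjd : DenseRange j)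
    (hj : ∀ v, Filter.Tendsto (fun n => ‖v.1 n‖) U (𝓝 ‖j v‖))
    (hjL : ∀ g v w, (∀ n, w.1 n = (ρ n).1.toHom g (v.1 n)) → L.1.toHom g (j v) = j w)
    {m : ℕ} (x : Fin m → L.1.E) {Q : Set G} (hQ : IsCompact Q) {η : ℝ} (hη : 0 < η) :
    ∀ᶠ n in (U : Filter ℕ), ∃ x' : Fin m → (ρ n).1.E, ∀ f : Fin m → C_c(G, ℂ),
      (∀ k, tsupport (f k) ⊆ Q ∧ normL1 (f k) ≤ 1) →
      |‖∑ k, (ρ n).1.op (f k) (x' k)‖ - ‖∑ k, L.1.op (f k) (x k)‖| ≤ η := by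
  obtain ⟨C, hC0, hC⟩ := BddRep.exists_bound hS hSsymm hSone hSgen hM hQ
  -- Four errors of at most `η / 4` will be added: `η₁` serves to replace `x k` by `j (v k)`, `η₂`
  -- to replace integrals by sums in `ρ n` and again in `L`; the last comes from the convergence of
  -- norms of finite combinations.
  let η₁ : ℝ := η / (4 * (m + 1) * (C + 1))
  let η₂ : ℝ := η / (4 * (m + 1))
  have hη₁ : 0 < η₁ := by positivity
  have hη₂ : 0 < η₂ := by positivity
  have hmη₂ : m * η₂ ≤ η / 4 := by
    calc m * η₂ ≤ (m + 1) * η₂ := by nlinarith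
      _ = η / 4 := by simp only [η₂]; field_simp
  have hmη₁ : m * (C * η₁) ≤ η / 4 := by
    calc m * (C * η₁) ≤ (m + 1) * ((C + 1) * η₁) := by gcongr <;> linarith
      _ = η / 4 := by simp only [η₁]; field_simp
  have hv : ∀ k, ∃ v, ‖x k - j v‖ ≤ η₁ := by
    intro k
    obtain ⟨v, hv⟩ := hjd.exists_dist_lt (x k) hη₁
    exact ⟨v, by rw [← dist_eq_norm]; exact hv.le⟩
  choose v hv using hv
  let A : G → V → V := fun g u => ⟨fun n => (ρ n).1.toHom g (u.1 n), hVinv g u.1 u.2⟩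
  have hA : ∀ g u, L.1.toHom g (j u) = j (A g u) := fun g u => hjL g u _ fun n => rfl
  -- Oscillation is bounded for all `n` at once, so the same points and weights serve every `ρ n` as
  -- well as `L`.
  let W : G → Set G := fun i => {g | ∀ k n,
    ‖(ρ n).1.toHom g ((v k).1 n) - (ρ n).1.toHom i ((v k).1 n)‖ ≤ η₂}
  have hW : ∀ g ∈ Q, W g ∈ 𝓝 g := fun g _ =>
    Filter.eventually_all.2 fun k => hVeq (v k).1 (v k).2 g η₂ hη₂
  obtain ⟨t, c, hc1, -, hc⟩ := exists_finset_approx_avg hQ hW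
  filter_upwards [eventually_abs_norm_sum_sub_le U hV j hj
    (fun p : Fin m × t => A p.2 (v p.1)) (show 0 < η / 4 by positivity)] with n hn
  refine ⟨fun k => (v k).1 n, fun f hf => ?_⟩
  let a := ∑ k, (ρ n).1.op (f k) ((v k).1 n)
  let a' := ∑ k, ∑ i ∈ t, c (f k) i • (ρ n).1.toHom i ((v k).1 n)
  let b := ∑ k, L.1.op (f k) (j (v k))
  let b' := ∑ k, ∑ i ∈ t, c (f k) i • L.1.toHom i (j (v k))
  have ha : ‖a - a'‖ ≤ η / 4 := by
    refine le_trans ?_ hmη₂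
    simp only [a, a', ← Finset.sum_sub_distrib]
    refine (norm_sum_le_of_le (n := fun _ => η₂) _ fun k _ => ?_).trans (by simp)
    refine (hc _ (fun g => (ρ n).1.toHom g ((v k).1 n)) η₂
      ((ρ n).1.continuous_orbit _) hη₂.le (fun i _ g hg => hg k n) (f k) (hf k).1).trans ?_
    exact mul_le_of_le_one_left hη₂.le (hf k).2
  have hb : ‖b - b'‖ ≤ η / 4 := by
    refine le_trans ?_ hmη₂
    simp only [b, b', ← Finset.sum_sub_distrib]
    refine (norm_sum_le_of_le (n := fun _ => η₂) _ fun k _ => ?_).trans (by simp)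
    refine (hc _ (fun g => L.1.toHom g (j (v k))) η₂
      (L.1.continuous_orbit _) hη₂.le (fun i _ g hg => ?_) (f k) (hf k).1).trans ?_
    · rw [hA, hA, ← map_sub]
      exact le_of_tendsto (hj _) (Filter.Eventually.of_forall fun n => hg k n)
    · exact mul_le_of_le_one_left hη₂.le (hf k).2
  have hab : |‖a'‖ - ‖b'‖| ≤ η / 4 := by
    have := hn (fun p => c (f p.1) p.2) fun p => (hc1 _ _).trans (hf p.1).2
    simp only [Fintype.sum_prod_type, ← hA] at this
    simp only [a', b', ← Finset.sum_coe_sort t]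
    exact this
  have hx : ‖b - ∑ k, L.1.op (f k) (x k)‖ ≤ η / 4 := by
    refine le_trans ?_ hmη₁
    simp only [b, ← Finset.sum_sub_distrib, ← map_sub]
    refine (norm_sum_le_of_le (n := fun _ => C * η₁) _ fun k _ => ?_).trans (by simp)
    refine (L.norm_op_le (fun g hg => (hC L g hg).1) (hf k).1 _).trans ?_
    have h1 : ‖j (v k) - x k‖ ≤ η₁ := by rw [norm_sub_rev]; exact hv k
    have h2 : C * ‖j (v k) - x k‖ ≤ C * η₁ := mul_le_mul_of_nonneg_left h1 hC0
    exact (mul_le_of_le_one_left (by positivity) (hf k).2).trans h2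
  have e1 := (abs_norm_sub_norm_le _ _).trans ha
  have e2 := (abs_norm_sub_norm_le _ _).trans hb
  have e3 := (abs_norm_sub_norm_le _ _).trans hx
  change |‖a‖ - _| ≤ η
  rw [abs_le] at *
  constructor <;> linarith [e1.1, e1.2, e2.1, e2.2, e3.1, e3.2, hab.1, hab.2]

/-- Closed sets of representations are stable under ultralimits. -/
theorem BddRep.ultralimit_mem [T2Space G] {S : Set G} (hS : IsCompact S)
    (hSsymm : ∀ g ∈ S, g⁻¹ ∈ S) (hSone : (1 : G) ∈ S) (hSgen : Subgroup.closure S = ⊤) {M : ℝ}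
    (hM : 1 ≤ M) (U : Ultrafilter ℕ) {ρ : ℕ → BddRep S M} {V : Submodule ℂ (∀ n, (ρ n).1.E)}
    (hV : ∀ v ∈ V, ∃ C, ∀ n, ‖v n‖ ≤ C)
    (hVinv : ∀ g, ∀ v ∈ V, (fun n => (ρ n).1.toHom g (v n)) ∈ V)
    (hVeq : ∀ v ∈ V, ∀ g₀, ∀ η > 0,
      ∀ᶠ g in 𝓝 g₀, ∀ n, ‖(ρ n).1.toHom g (v n) - (ρ n).1.toHom g₀ (v n)‖ ≤ η)
    {L : BddRep S M} (j : V →ₗ[ℂ] L.1.E) (hjd : DenseRange j)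
    (hj : ∀ v, Filter.Tendsto (fun n => ‖v.1 n‖) U (𝓝 ‖j v‖))
    (hjL : ∀ g v w, (∀ n, w.1 n = (ρ n).1.toHom g (v.1 n)) → L.1.toHom g (j v) = j w)
    {F : Set (BddRep S M)} (hF : IsClosed F) (hρ : ∀ n, ρ n ∈ F) : L ∈ F := by
  by_contra hL
  have key : ∀ O : Set (BddRep S M), IsOpen O → L ∈ O → ∀ᶠ n in (U : Filter ℕ), ρ n ∈ O := by
    intro O hO
    induction hO with
    | basic O hO =>
      obtain ⟨ρ₀, m, x₀, Q, ε, hQ, -, rfl⟩ := hO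
      rintro ⟨x, δ, hδ, hx⟩
      -- The strict inequality `δ < ε` in `basicNhd` leaves room, half of which pays for replacing
      -- `L` by `ρ n`.
      have hη : 0 < (ε - δ) / 2 := by linarith
      filter_upwards [BddRep.eventually_exists_approx hS hSsymm hSone hSgen hM U hV hVinv hVeq j
        hjd hj hjL x hQ hη] with n hn
      obtain ⟨x', hx'⟩ := hn
      refine ⟨x', δ + (ε - δ) / 2, by linarith, fun f hf => ?_⟩
      have h1 := hx f hf
      have h2 := hx' f hf
      exact (abs_sub_le _ ‖∑ k, L.1.op (f k) (x k)‖ _).trans (by linarith)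
    | univ => exact fun _ => Filter.Eventually.of_forall fun _ => trivial
    | inter O O' _ _ h h' => exact fun hm => (h hm.1).and (h' hm.2)
    | sUnion 𝒰 _ ih =>
      rintro ⟨O, hO, hm⟩
      exact (ih O hO hm).mono fun n hn => ⟨O, hO, hn⟩
  obtain ⟨n, hn⟩ := (key _ hF.isOpen_compl hL).exists
  exact hn (hρ n)

end ClosedUnderLimits

/-! ### From a Kazhdan projection and vanishing H¹ to a contraction -/

section KazhdanContraction

variable {G : Type*} [Group G] [TopologicalSpace G]

theorem BanachRep.exists_eq_sub_of_subsingleton {ρ : BanachRep G} (h : Subsingleton ρ.H1)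
    {b : G → ρ.E} (hb : b ∈ ρ.Z1) : ∃ x, ∀ g, b g = x - ρ.toHom g x := by
  have h1 : ρ.B1.submoduleOf ρ.Z1 = ⊤ := Submodule.Quotient.subsingleton_iff.1 h
  have h2 : (⟨b, hb⟩ : ρ.Z1) ∈ ρ.B1.submoduleOf ρ.Z1 := h1 ▸ Submodule.mem_top
  exact h2

theorem BanachRep.subsingleton_H1 {ρ : BanachRep G}
    (h : ∀ b ∈ ρ.Z1, ∃ x, ∀ g, b g = x - ρ.toHom g x) : Subsingleton ρ.H1 := by
  refine Submodule.Quotient.subsingleton_iff.2 (eq_top_iff.2 ?_)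
  rintro ⟨b, hb⟩ -
  exact h b hb

theorem BanachRep.sub_toHom_mem_Z1 (ρ : BanachRep G) (x : ρ.E) :
    (fun g => x - ρ.toHom g x) ∈ ρ.Z1 :=
  ⟨continuous_const.sub (ρ.continuous_orbit x), fun g h => by simp [map_mul]⟩

theorem OpFamily.norm_sub_le_of_supDist {F : Set (BanachRep G)} {p q : OpFamily F} {ε : ℝ}
    (hε : 0 ≤ ε) (h : OpFamily.supDist p q ≤ ENNReal.ofReal ε) (ρ : F) : ‖p ρ - q ρ‖ ≤ ε := by
  have h1 : ‖p ρ - q ρ‖ₑ ≤ ENNReal.ofReal ε := (le_iSup (fun ρ => ‖p ρ - q ρ‖ₑ) ρ).trans h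
  rwa [← ofReal_norm, ENNReal.ofReal_le_ofReal_iff hε] at h1

variable [IsTopologicalGroup G] [LocallyCompactSpace G]

theorem BanachRep.avg_sub_toHom (ρ : BanachRep G) {f : C_c(G, ℂ)}
    (hf : haarIntegral (fun g => f g) = 1) (x : ρ.E) :
    avg f (fun g => x - ρ.toHom g x) = x - ρ.op f x := by
  rw [avg_sub f continuous_const (ρ.continuous_orbit x), avg_const, hf, one_smul]
  rfl

theorem exists_norm_sub_op_le {F : Set (BanachRep G)} {p : OpFamily F}
    (hp : IsKazhdanProjection F p) {ε : ℝ} (hε : 0 < ε) :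
    ∃ f : C_c(G, ℂ), haarIntegral (fun g => f g) = 1 ∧ ∀ ρ : F, ‖p ρ - ρ.1.op f‖ ≤ ε := by
  obtain ⟨f, hf, hpf⟩ := hp.mem_closure (ENNReal.ofReal ε) (ENNReal.ofReal_pos.2 hε)
  exact ⟨f, hf, OpFamily.norm_sub_le_of_supDist hε.le hpf.le⟩

/-- If there is a Kazhdan projection and the first cohomology vanishes, affine actions are
contracted by averaging. -/
theorem exists_contracting_of_kazhdan [T2Space G] {T : Set G} (hT : IsCompact T)
    (hTsymm : ∀ g ∈ T, g⁻¹ ∈ T) (hTone : (1 : G) ∈ T) (hTgen : Subgroup.closure T = ⊤)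
    {M : ℝ} (hM : 1 ≤ M) {F : Set (BanachRep G)} (hF : ∀ σ ∈ F, ∀ g ∈ T, ‖σ.toHom g‖ ≤ M)
    (hK : HasKazhdanProjection F) (hH1 : ∀ σ ∈ F, Subsingleton σ.H1) {ε : ℝ} (hε : 0 < ε) :
    ∃ f : C_c(G, ℂ), haarIntegral (fun g => f g) = 1 ∧
      ∀ σ ∈ F, ∀ β ∈ σ.Z1, ∀ D : ℝ, (∀ s ∈ T, ‖β s‖ ≤ D) →
        ∀ g ∈ T, ‖β g + σ.toHom g (avg f β) - avg f β‖ ≤ ε * D := by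
  obtain ⟨p, hp⟩ := hK
  -- A crude approximation of `p` bounds fixed points by displacement: if `P x' = 0` then `‖π(f₁)x'‖
  -- ≤ ‖x'‖ / 2`, so `‖x'‖ ≤ 2 ‖x' - π(f₁)x'‖ = 2 ‖∫ f₁ β‖`. The precision of `f` is then chosen
  -- from the resulting `C₀`.
  obtain ⟨f₁, hf₁, hpf₁⟩ := exists_norm_sub_op_le hp (ε := 1 / 2) (by norm_num)
  obtain ⟨C, hC0, hC⟩ := BddRep.exists_bound hT hTsymm hTone hTgen hM
    f₁.hasCompactSupport.isCompact
  have hn1 := normL1_nonneg f₁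
  let C₀ : ℝ := 2 * (normL1 f₁ * C)
  have hC₀ : 0 ≤ C₀ := by positivity
  obtain ⟨f, hf, hpf⟩ := exists_norm_sub_op_le hp (ε := ε / ((M + 1) * (C₀ + 1)))
    (by positivity)
  refine ⟨f, hf, fun σ hσ β hβ D hD g hg => ?_⟩
  have hD0 : 0 ≤ D := (norm_nonneg _).trans (hD 1 hTone)
  let P : σ.E →L[ℂ] σ.E := p ⟨σ, hσ⟩
  obtain ⟨hPid, hPrange⟩ := hp.projection ⟨σ, hσ⟩
  obtain ⟨x, hx⟩ := BanachRep.exists_eq_sub_of_subsingleton (hH1 σ hσ) hβ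
  have hinv : ∀ h, σ.toHom h (P x) = P x := by
    have : P x ∈ σ.invariants := hPrange ▸ ⟨x, rfl⟩
    exact this
  -- Removing the invariant part leaves the coboundary unchanged and puts the fixed point in the
  -- kernel of `P`.
  let x' := x - P x
  have hPx' : P x' = 0 := by
    have : P (P x) = P x := congrArg (fun A => A x) hPid
    simp [x', this]
  have hβ' : β = fun h => x' - σ.toHom h x' := by
    ext h
    simp [x', hx h, hinv h]
  have hx'norm : ‖x'‖ ≤ C₀ * D := by
    have h1 : ‖x' - σ.op f₁ x'‖ ≤ normL1 f₁ * (C * D) := by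
      rw [← σ.avg_sub_toHom hf₁, ← hβ']
      exact norm_avg_le f₁ fun h hh => (hC ⟨σ, hF σ hσ⟩ h hh).2 β hβ D hD
    have h2 : ‖σ.op f₁ x'‖ ≤ 1 / 2 * ‖x'‖ := by
      have := (P - σ.op f₁).le_of_opNorm_le (hpf₁ ⟨σ, hσ⟩) x'
      simpa [hPx'] using this
    have h3 := norm_sub_norm_le x' (σ.op f₁ x')
    simp only [C₀]
    linarith
  let z := σ.op f x'
  have hz : ‖z‖ ≤ ε / (M + 1) * D := by
    have h1 := (P - σ.op f).le_of_opNorm_le (hpf ⟨σ, hσ⟩) x'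
    have h2 : ‖z‖ ≤ ε / ((M + 1) * (C₀ + 1)) * ‖x'‖ := by simpa [hPx'] using h1
    have h3 : ‖x'‖ ≤ (C₀ + 1) * D := hx'norm.trans (by linarith)
    refine h2.trans ((mul_le_mul_of_nonneg_left h3 (by positivity)).trans_eq ?_)
    field_simp
  -- The average misses the fixed point `x'` by the small vector `z`, so the new displacement is `z
  -- - π(g)z`.
  have hy : avg f β = x' - z := by
    rw [hβ', σ.avg_sub_toHom hf]
  have e : β g + σ.toHom g (avg f β) - avg f β = z - σ.toHom g z := by
    rw [hy, hβ']
    simp only [map_sub]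
    abel
  rw [e]
  have h1 := (σ.toHom g).le_of_opNorm_le (hF σ hσ g hg) z
  calc ‖z - σ.toHom g z‖ ≤ (M + 1) * ‖z‖ := (norm_sub_le _ _).trans (by linarith)
    _ ≤ (M + 1) * (ε / (M + 1) * D) := by gcongr
    _ = ε * D := by field_simp

end KazhdanContraction

/-! ### Representations and cocycles that factor through a quotient -/

section Quotients

variable {G : Type*} [Group G] [TopologicalSpace G]

/-- The representation of `G ⧸ N` defined by a representation of `G` that is trivial on `N`. -/
abbrev BanachRep.descend (ρ : BanachRep G) (N : Subgroup G) [N.Normal]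
    (h : ∀ n ∈ N, ρ.toHom n = 1) : BanachRep (G ⧸ N) where
  E := ρ.E
  toHom := QuotientGroup.lift N ρ.toHom h
  continuous_orbit x := by
    rw [(QuotientGroup.isQuotientMap_mk N).continuous_iff]
    exact ρ.continuous_orbit x

theorem BanachRep.exists_descend_cocycle (ρ : BanachRep G) (N : Subgroup G) [N.Normal]
    (h : ∀ n ∈ N, ρ.toHom n = 1) {b : G → ρ.E} (hb : b ∈ ρ.Z1) (hbN : ∀ n ∈ N, b n = 0) :
    ∃ β ∈ (ρ.descend N h).Z1, ∀ g : G, β (g : G ⧸ N) = b g := by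
  have hwd : ∀ g g' : G, (g : G ⧸ N) = g' → b g = b g' := by
    intro g g' hg
    have h1 := hb.2 g (g⁻¹ * g')
    rw [mul_inv_cancel_left, hbN _ (QuotientGroup.eq.1 hg), map_zero, add_zero] at h1
    exact h1.symm
  let β : G ⧸ N → ρ.E := fun x => b x.out
  have hβ : ∀ g : G, β (g : G ⧸ N) = b g := fun g => hwd _ _ (QuotientGroup.out_eq' _)
  refine ⟨β, ⟨?_, fun x y => ?_⟩, hβ⟩
  · refine (QuotientGroup.isQuotientMap_mk N).continuous_iff.2 ?_
    exact hb.1.congr fun g => (hβ g).symm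
  · obtain ⟨g, rfl⟩ := QuotientGroup.mk_surjective x
    obtain ⟨g', rfl⟩ := QuotientGroup.mk_surjective y
    rw [← QuotientGroup.mk_mul]
    change β _ = β _ + ρ.toHom g (β _)
    rw [hβ, hβ, hβ]
    exact hb.2 g g'

theorem BanachRep.pullback_mem_Z1 {N : Subgroup G} [N.Normal] {σ : BanachRep (G ⧸ N)}
    {β : G ⧸ N → σ.E} (hβ : β ∈ σ.Z1) : (fun g : G => β g) ∈ (σ.pullback N).Z1 :=
  ⟨hβ.1.comp continuous_quot_mk, fun g h => hβ.2 g h⟩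

end Quotients

/-! ### Smoothing a cocycle by moving its base point -/

section Smoothing

variable {G : Type*} [Group G] [TopologicalSpace G] [IsTopologicalGroup G]
  [LocallyCompactSpace G]

/-- The cocycle `b`, with the base point moved to its average `∫ φ b`. -/
noncomputable def smoothCocycle {E : Type*} [NormedAddCommGroup E] [NormedSpace ℂ E]
    (φ : C_c(G, ℂ)) (b : G → E) (g : G) : E :=
  avg φ (fun h => b (g * h)) - avg φ b

variable {ρ : BanachRep G} {φ : C_c(G, ℂ)} {b : G → ρ.E}

/-- An affine map commutes with averages of total mass 1. -/
theorem avg_cocycle_mul (hφ : haarIntegral (fun g => φ g) = 1) (hb : b ∈ ρ.Z1) (g : G) :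
    avg φ (fun h => b (g * h)) = b g + ρ.toHom g (avg φ b) := by
  simp only [hb.2 g]
  rw [avg_add φ (χ := fun h => ρ.toHom g (b h)) continuous_const ((ρ.toHom g).continuous.comp hb.1), avg_const, hφ, one_smul,
    avg_map φ _ hb.1]

theorem smoothCocycle_eq (hφ : haarIntegral (fun g => φ g) = 1) (hb : b ∈ ρ.Z1) (g : G) :
    smoothCocycle φ b g = b g + ρ.toHom g (avg φ b) - avg φ b := by
  rw [smoothCocycle, avg_cocycle_mul hφ hb]

theorem smoothCocycle_mem_Z1 (hφ : haarIntegral (fun g => φ g) = 1) (hb : b ∈ ρ.Z1) :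
    smoothCocycle φ b ∈ ρ.Z1 := by
  have h := ρ.Z1.sub_mem hb (ρ.sub_toHom_mem_Z1 (avg φ b))
  convert h using 1
  ext g
  rw [smoothCocycle_eq hφ hb]
  simp only [Pi.sub_apply]
  abel

/-- With `y = ∫ φ b`, the base point on the left is `∑ cᵢ kᵢ·y`, and affine maps respect
combinations of total weight 1. The right side involves finitely many values of the smoothed
cocycle, which is what an ultralimit can see. -/
theorem avg_sum_leftTranslate_cocycle {ι : Type*} (s : Finset ι) {c : ι → ℂ} {k : ι → G}
    (hφ : haarIntegral (fun g => φ g) = 1) (hc : ∑ i ∈ s, c i = 1) (hb : b ∈ ρ.Z1) (g : G) :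
    b g + ρ.toHom g (avg (∑ i ∈ s, c i • leftTranslate (k i) φ) b) -
        avg (∑ i ∈ s, c i • leftTranslate (k i) φ) b =
      ∑ i ∈ s, c i • (smoothCocycle φ b (g * k i) - smoothCocycle φ b (k i)) := by
  rw [avg_sum_smul_left s c _ hb.1, map_sum]
  have h1 : b g = ∑ i ∈ s, c i • b g := by rw [← Finset.sum_smul, hc, one_smul]
  rw [h1, ← Finset.sum_add_distrib, ← Finset.sum_sub_distrib]
  refine Finset.sum_congr rfl fun i _ => ?_
  rw [avg_leftTranslate, smoothCocycle_eq hφ hb, smoothCocycle_eq hφ hb, avg_cocycle_mul hφ hb,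
    hb.2 g (k i), map_mul, map_smul, ← smul_add, ← smul_sub]
  congr 1
  simp only [map_add, mul_apply_eq_comp]
  abel

theorem haarIntegral_sum_leftTranslate {ι : Type*} (s : Finset ι) {c : ι → ℂ} {k : ι → G}
    (hφ : haarIntegral (fun g => φ g) = 1) (hc : ∑ i ∈ s, c i = 1) :
    haarIntegral (fun g => (∑ i ∈ s, c i • leftTranslate (k i) φ) g) = 1 := by
  rw [haarIntegral_eq_avg_one, avg_sum_smul_left s c _ continuous_const]
  simp [avg_leftTranslate, avg_one, hφ, hc]

theorem BddRep.exists_bound_smoothCocycle [T2Space G] {S : Set G} (hS : IsCompact S)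
    (hSsymm : ∀ g ∈ S, g⁻¹ ∈ S) (hSone : (1 : G) ∈ S) (hSgen : Subgroup.closure S = ⊤) {M : ℝ}
    (hM : 1 ≤ M) (φ : C_c(G, ℂ)) {K : Set G} (hK : IsCompact K) :
    ∃ C : ℝ, 0 ≤ C ∧ ∀ ρ : BddRep S M, ∀ b ∈ ρ.1.Z1, (∀ s ∈ S, ‖b s‖ ≤ 1) →
      ∀ g ∈ K, ‖smoothCocycle φ b g‖ ≤ C := by
  let K' : Set G := (fun p : G × G => p.1 * p.2) '' (insert 1 K ×ˢ tsupport φ)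
  have hK' : IsCompact K' :=
    ((hK.insert 1).prod φ.hasCompactSupport.isCompact).image continuous_mul
  obtain ⟨C, hC0, hC⟩ := BddRep.exists_bound hS hSsymm hSone hSgen hM hK'
  have hn := normL1_nonneg φ
  refine ⟨normL1 φ * C + normL1 φ * C, by positivity, fun ρ b hb hb1 g hg => ?_⟩
  refine (norm_sub_le _ _).trans (add_le_add ?_ ?_)
  · refine norm_avg_le φ fun h hh => ?_
    simpa using (hC ρ (g * h) ⟨(g, h), ⟨Set.mem_insert_of_mem _ hg, hh⟩, rfl⟩).2 b hb 1 hb1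
  · refine norm_avg_le φ fun h hh => ?_
    simpa using (hC ρ h ⟨(1, h), ⟨Set.mem_insert _ _, hh⟩, one_mul h⟩).2 b hb 1 hb1

end Smoothing

/-! ### Limits of cocycles that are asymptotically trivial on the normal subgroup -/

section LimitCocycle

universe u

variable {G : Type u} [Group G] [TopologicalSpace G] [IsTopologicalGroup G]
  [LocallyCompactSpace G] [T2Space G] [TopologicalSpace.SeparableSpace G]

/-- Ultralimits of representations of a closed family, and of bounded equicontinuous cocycles,
which are asymptotically trivial on `N`. -/
theorem BddRep.exists_limit_cocycle {S : Set G} (hS : IsCompact S)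
    (hSsymm : ∀ g ∈ S, g⁻¹ ∈ S) (hSone : (1 : G) ∈ S) (hSgen : Subgroup.closure S = ⊤) {M : ℝ}
    (hM : 1 ≤ M) (N : Subgroup G) [N.Normal] {F : Set (BddRep S M)} (hF : IsClosed F)
    (U : Ultrafilter ℕ) {ρ : ℕ → BddRep S M} (hρF : ∀ n, ρ n ∈ F) {x : G → ∀ n, (ρ n).1.E}
    (hx : ∀ n, (fun g => x g n) ∈ (ρ n).1.Z1) (hxb : ∀ g, ∃ C, ∀ n, ‖x g n‖ ≤ C)
    (heq : ∀ g₀, ∀ η > 0, ∀ᶠ g in 𝓝 g₀, ∀ n, ‖x g n - x g₀ n‖ ≤ η)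
    (hN : ∀ g ∈ N, ∀ᶠ n in (U : Filter ℕ), (ρ n).1.toHom g = 1 ∧ x g n = 0) :
    ∃ σ ∈ BddRep.factoring F N, ∃ β ∈ σ.Z1, ∀ {κ : Type u} (s : Finset κ) (c : κ → ℂ)
      (k k' : κ → G), Filter.Tendsto (fun n => ‖∑ i ∈ s, c i • (x (k i) n - x (k' i) n)‖) U
        (𝓝 ‖∑ i ∈ s, c i • (β (k i : G ⧸ N) - β (k' i : G ⧸ N))‖) := by
  have hρ : ∀ g₀, ∃ C, ∀ᶠ g in 𝓝 g₀, ∀ n, ‖(ρ n).1.toHom g‖ ≤ C := by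
    intro g₀
    obtain ⟨K, hK, hKg⟩ := exists_compact_mem_nhds g₀
    obtain ⟨C, -, hC⟩ := BddRep.exists_bound hS hSsymm hSone hSgen hM hK
    exact ⟨C, Filter.mem_of_superset hKg fun g hg n => (hC (ρ n) g hg).1⟩
  obtain ⟨L, j, hjd, hj, hjL⟩ := exists_ultralimit (ρ := fun n => (ρ n).1) U hx hxb hρ heq
  let V := Submodule.span ℂ (Set.range x)
  have hVinv := toHom_mem_span (ρ := fun n => (ρ n).1) hx
  have hLbound : ∀ g ∈ S, ‖L.toHom g‖ ≤ M := by
    intro g hg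
    refine ContinuousLinearMap.opNorm_le_bound _ (by linarith) fun y => ?_
    induction y using hjd.induction_on with
    | hp => exact isClosed_le (by fun_prop) (by fun_prop)
    | ih v =>
      rw [hjL g v ⟨_, hVinv g v.1 v.2⟩ fun n => rfl]
      refine le_of_tendsto_of_tendsto (hj _) ((hj v).const_mul M)
        (Filter.Eventually.of_forall fun n => ?_)
      exact ((ρ n).1.toHom g).le_of_opNorm_le ((ρ n).2 g hg) _
  have hLF : (⟨L, hLbound⟩ : BddRep S M) ∈ F :=
    BddRep.ultralimit_mem hS hSsymm hSone hSgen hM U (bounded_of_mem_span hxb) hVinv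
      (equicontinuous_of_mem_span (ρ := fun n => (ρ n).1) hx heq) (L := ⟨L, hLbound⟩) j hjd hj hjL
      hF hρF
  have hLN : ∀ g ∈ N, L.toHom g = 1 := by
    intro g hg
    ext y
    induction y using hjd.induction_on with
    | hp => exact isClosed_eq (by fun_prop) (by fun_prop)
    | ih v =>
      rw [hjL g v ⟨_, hVinv g v.1 v.2⟩ fun n => rfl]
      refine sub_eq_zero.1 (norm_eq_zero.1 ?_)
      change ‖_ - j v‖ = 0
      rw [← map_sub]
      refine tendsto_nhds_unique (hj _) (tendsto_const_nhds.congr' ?_)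
      filter_upwards [hN g hg] with n hn
      simp [hn.1]
  let vec : G → V := fun g => ⟨x g, Submodule.subset_span ⟨g, rfl⟩⟩
  have hvec : (fun g => j (vec g)) ∈ L.Z1 := by
    refine ⟨?_, fun g h => ?_⟩
    · rw [Metric.continuous_iff']
      intro g₀ ε hε
      filter_upwards [heq g₀ (ε / 2) (half_pos hε)] with g hg
      rw [dist_eq_norm, ← map_sub]
      exact lt_of_le_of_lt (le_of_tendsto (hj _) (Filter.Eventually.of_forall hg))
        (half_lt_self hε)
    · simp only
      rw [hjL g (vec h) (vec (g * h) - vec g) fun n => ?_, map_sub, add_sub_cancel]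
      have := (hx n).2 g h
      simp only at this
      simp [vec, this]
  have hvecN : ∀ g ∈ N, j (vec g) = 0 := by
    intro g hg
    refine norm_eq_zero.1 (tendsto_nhds_unique (hj _) (tendsto_const_nhds.congr' ?_))
    filter_upwards [hN g hg] with n hn
    simp [vec, hn.2]
  obtain ⟨β, hβ, hβv⟩ := L.exists_descend_cocycle N hLN hvec hvecN
  refine ⟨L.descend N hLN, ⟨hLbound, hLF⟩, β, hβ, fun s c k k' => ?_⟩
  have := hj (∑ i ∈ s, c i • (vec (k i) - vec (k' i)))
  simp only [map_sum, map_smul, map_sub, Submodule.coe_sum, Submodule.coe_smul, Submodule.coe_sub,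
    Finset.sum_apply, Pi.smul_apply, Pi.sub_apply] at this
  simp only [hβv]
  exact this

end LimitCocycle

/-! ### The contraction is inherited by an intermediate quotient -/

section UniformContraction

variable {G : Type*} [Group G] [TopologicalSpace G] [IsTopologicalGroup G]
  [LocallyCompactSpace G]

theorem avg_smul {E : Type*} [NormedAddCommGroup E] [NormedSpace ℂ E] (f : C_c(G, ℂ)) (c : ℂ)
    (ψ : G → E) : avg f (fun g => c • ψ g) = c • avg f ψ := by
  borelize G
  simp only [avg, smul_comm _ c]
  exact integral_smul c _

/-- A bound on the displacement of `∫ f b` for cocycles bounded by `1` on `S` scales. -/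
theorem norm_displacement_le_of_forall_le_one {S : Set G} (hSone : (1 : G) ∈ S) {ρ : BanachRep G}
    {ψ : C_c(G, ℂ)} {κ : ℝ} {P : (G → ρ.E) → Prop} (hP : ∀ (c : ℂ) b, P b → P (c • b))
    (h : ∀ b ∈ ρ.Z1, P b → (∀ s ∈ S, ‖b s‖ ≤ 1) →
      ∀ g ∈ S, ‖b g + ρ.toHom g (avg ψ b) - avg ψ b‖ ≤ κ)
    {b : G → ρ.E} (hb : b ∈ ρ.Z1) (hPb : P b) {D : ℝ} (hD : ∀ s ∈ S, ‖b s‖ ≤ D) :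
    ∀ g ∈ S, ‖b g + ρ.toHom g (avg ψ b) - avg ψ b‖ ≤ κ * D := by
  intro g hg
  -- The bound `D = 0` cannot be normalised to 1, so the positive case is applied to `D + δ` and `δ`
  -- tends to 0.
  have hpos : ∀ D' > 0, (∀ s ∈ S, ‖b s‖ ≤ D') →
      ‖b g + ρ.toHom g (avg ψ b) - avg ψ b‖ ≤ κ * D' := by
    intro D' hD' hb'
    have hDc : ‖((D' : ℂ)⁻¹)‖ = D'⁻¹ := by
      rw [norm_inv, Complex.norm_real, Real.norm_eq_abs, abs_of_pos hD']
    have h1 := h ((D' : ℂ)⁻¹ • b) (ρ.Z1.smul_mem _ hb) (hP _ _ hPb) (fun s hs => by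
      rw [Pi.smul_apply, norm_smul, hDc]
      calc D'⁻¹ * ‖b s‖ ≤ D'⁻¹ * D' := by gcongr; exact hb' s hs
        _ = 1 := inv_mul_cancel₀ hD'.ne') g hg
    have h2 : avg ψ ((D' : ℂ)⁻¹ • b) = (D' : ℂ)⁻¹ • avg ψ b := avg_smul ψ _ b
    rw [h2, Pi.smul_apply, map_smul, ← smul_add, ← smul_sub, norm_smul, hDc,
      inv_mul_le_iff₀ hD'] at h1
    linarith
  have hD0 : 0 ≤ D := (norm_nonneg _).trans (hD 1 hSone)
  have hlim : Filter.Tendsto (fun δ : ℝ => κ * (D + δ)) (𝓝[>] 0) (𝓝 (κ * D)) := by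
    have : Filter.Tendsto (fun δ : ℝ => κ * (D + δ)) (𝓝 0) (𝓝 (κ * (D + 0))) :=
      Continuous.tendsto (by fun_prop) 0
    rw [add_zero] at this
    exact this.mono_left nhdsWithin_le_nhds
  refine ge_of_tendsto hlim ?_
  filter_upwards [self_mem_nhdsWithin] with δ hδ
  have hδ' : 0 < δ := hδ
  exact hpos _ (by linarith) fun s hs => (hD s hs).trans (by linarith)

/-- Compactness: `ψ` is built from a contraction for `G ⧸ N` before `m` is chosen. Counterexamples
for every `m` would have an ultralimit that lives on `G ⧸ N`, where the displacement in question is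
at most 1/4, whereas each counterexample exceeds 1/2. -/
theorem BddRep.exists_contracting [T2Space G] [TopologicalSpace.SeparableSpace G]
    {S : Set G} (hS : IsCompact S)
    (hSsymm : ∀ g ∈ S, g⁻¹ ∈ S) (hSone : (1 : G) ∈ S) (hSgen : Subgroup.closure S = ⊤) {M : ℝ}
    (hM : 1 ≤ M) (N : Subgroup G) [N.Normal] (hNcl : IsClosed (N : Set G))
    {F : Set (BddRep S M)} (hF : IsClosed F)
    (hK : HasKazhdanProjection (BddRep.factoring F N))
    (hH1 : ∀ σ ∈ BddRep.factoring F N, Subsingleton σ.H1)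
    {A : ℕ → Subgroup G} (hA : ∀ g ∈ N, ∀ᶠ m in Filter.atTop, g ∈ A m) :
    ∃ ψ : C_c(G, ℂ), haarIntegral (fun g => ψ g) = 1 ∧ ∃ m, ∀ ρ ∈ F,
      (∀ n ∈ A m, ρ.1.toHom n = 1) → ∀ b ∈ ρ.1.Z1, (∀ n ∈ A m, b n = 0) →
        ∀ D : ℝ, (∀ s ∈ S, ‖b s‖ ≤ D) →
          ∀ g ∈ S, ‖b g + ρ.1.toHom g (avg ψ b) - avg ψ b‖ ≤ 1 / 2 * D := by
  classical
  obtain ⟨φ, hφ⟩ := exists_haarIntegral_eq_one (G := G)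
  obtain ⟨C, hC0, hC⟩ := BddRep.exists_bound_smoothCocycle hS hSsymm hSone hSgen hM φ hS
  have : T2Space (G ⧸ N) := inferInstance
  let q : G → G ⧸ N := fun g => (g : G ⧸ N)
  have hq : Continuous q := continuous_quot_mk
  -- Smoothed cocycles are bounded on `S` by `C` instead of 1; this `ε` absorbs the loss and brings
  -- the displacement down to 1/8.
  obtain ⟨f, hf, hfc⟩ := exists_contracting_of_kazhdan (T := q '' S) (hS.image hq)
    (by rintro _ ⟨g, hg, rfl⟩; exact ⟨g⁻¹, hSsymm g hg, rfl⟩) ⟨1, hSone, rfl⟩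
    (by
      have := (MonoidHom.map_closure (QuotientGroup.mk' N) S).symm
      rw [hSgen, ← MonoidHom.range_eq_map, QuotientGroup.range_mk'] at this
      exact this)
    hM (F := BddRep.factoring F N) (by
      rintro σ ⟨hσ, -⟩ _ ⟨g, hg, rfl⟩
      exact hσ g hg)
    hK hH1 (ε := 1 / (8 * (C + 1))) (by positivity)
  have hnf := normL1_nonneg f
  -- Replacing `∫ f β` by a finite sum moves the base point by at most `‖f‖₁ η`, and so changes the
  -- displacement by at most `(M + 1) ‖f‖₁ η ≤ 1/8`.
  let η : ℝ := 1 / (8 * (normL1 f + 1) * (M + 1))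
  have hη : 0 < η := by positivity
  -- These neighbourhoods do not depend on the representation, so the limit cocycle inherits the
  -- oscillation bound `η` on their images.
  let W₀ : G → Set G := fun g₀ => {g | ∀ ρ : BddRep S M, ∀ b ∈ ρ.1.Z1, (∀ s ∈ S, ‖b s‖ ≤ 1) →
    ‖avg φ (fun h => b (g * h)) - avg φ (fun h => b (g₀ * h))‖ ≤ η}
  have hW₀ : ∀ g, W₀ g ∈ 𝓝 g := fun g =>
    BddRep.eventually_norm_avg_cocycle_le hS hSsymm hSone hSgen hM φ g hη
  let W : G ⧸ N → Set (G ⧸ N) := fun y => q '' W₀ y.out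
  have hW : ∀ y, W y ∈ 𝓝 y := by
    intro y
    have := (QuotientGroup.isOpenMap_coe (N := N)).image_mem_nhds (hW₀ y.out)
    rwa [QuotientGroup.out_eq'] at this
  obtain ⟨t, c, hc1, hcsum, hc⟩ := exists_finset_approx_avg
    f.hasCompactSupport.isCompact fun y _ => hW y
  have hcf : ∑ i ∈ t, c f i = 1 := (hcsum f subset_rfl).trans hf
  -- Point masses approximating `f`, lifted to `G` by `Quotient.out` and convolved with the
  -- smoothing function `φ`.
  refine ⟨∑ i ∈ t, c f i • leftTranslate i.out φ, haarIntegral_sum_leftTranslate t hφ hcf, ?_⟩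
  suffices hmain : ∃ m, ∀ ρ ∈ F, (∀ n ∈ A m, ρ.1.toHom n = 1) → ∀ b ∈ ρ.1.Z1,
      (∀ n ∈ A m, b n = 0) → (∀ s ∈ S, ‖b s‖ ≤ 1) → ∀ g ∈ S,
        ‖∑ i ∈ t, c f i • (smoothCocycle φ b (g * i.out) - smoothCocycle φ b i.out)‖ ≤ 1 / 2 by
    obtain ⟨m, hm⟩ := hmain
    refine ⟨m, fun ρ hρ hρA b hb hbA D hD => ?_⟩
    refine norm_displacement_le_of_forall_le_one hSone
      (P := fun b : G → ρ.1.E => ∀ n ∈ A m, b n = 0) (fun c b h n hn => by simp [h n hn])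
      (fun b hb hbA hb1 g hg => ?_) hb hbA hD
    rw [avg_sum_leftTranslate_cocycle t hφ hcf hb]
    exact hm ρ hρ hρA b hb hbA hb1 g hg
  by_contra hcon
  push Not at hcon
  choose ρ hρF hρA b hb hbA hb1 g hgS hg using hcon
  let U : Ultrafilter ℕ := Filter.hyperfilter ℕ
  let x : G → ∀ n, (ρ n).1.E := fun g n => smoothCocycle φ (b n) g
  have hxdiff : ∀ g g₀ n, x g n - x g₀ n =
      avg φ (fun h => b n (g * h)) - avg φ (fun h => b n (g₀ * h)) := by
    intro g g₀ n
    simp only [x, smoothCocycle]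
    abel
  have heq : ∀ g₀, ∀ η > 0, ∀ᶠ g in 𝓝 g₀, ∀ n, ‖x g n - x g₀ n‖ ≤ η := by
    intro g₀ η hη
    filter_upwards [BddRep.eventually_norm_avg_cocycle_le hS hSsymm hSone hSgen hM φ g₀ hη]
      with g hg n
    rw [hxdiff]
    exact hg (ρ n) (b n) (hb n) (hb1 n)
  obtain ⟨σ, hσF, β, hβ, hlim⟩ := BddRep.exists_limit_cocycle hS hSsymm hSone hSgen hM N hF U
    hρF (x := x) (fun n => smoothCocycle_mem_Z1 hφ (hb n))
    (by
      intro g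
      obtain ⟨C, -, hC⟩ := BddRep.exists_bound_smoothCocycle hS hSsymm hSone hSgen hM φ
        (isCompact_singleton (x := g))
      exact ⟨C, fun n => hC (ρ n) (b n) (hb n) (hb1 n) g rfl⟩)
    heq
    (by
      intro g hg
      have h1 : ∀ᶠ n in (U : Filter ℕ), g ∈ A n :=
        Nat.hyperfilter_le_atTop (hA g hg)
      filter_upwards [h1] with n hn
      refine ⟨hρA n g hn, ?_⟩
      simp only [x]
      rw [smoothCocycle_eq hφ (hb n), hbA n g hn, hρA n g hn]
      simp)
  have hlim1 : ∀ g, Filter.Tendsto (fun n => ‖x g n‖) U (𝓝 ‖β (q g)‖) := by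
    intro g
    have h1 := hlim {g} (fun _ => 1) id fun _ => 1
    have h2 : ∀ n, x 1 n = 0 := fun n =>
      BanachRep.cocycle_one (smoothCocycle_mem_Z1 hφ (hb n))
    have h3 : β ((1 : G) : G ⧸ N) = 0 := BanachRep.cocycle_one hβ
    simpa only [Finset.sum_singleton, one_smul, h2, h3, sub_zero, id] using h1
  have hlim2 : ∀ g g₀, Filter.Tendsto (fun n => ‖x g n - x g₀ n‖) U (𝓝 ‖β (q g) - β (q g₀)‖) := by
    intro g g₀
    simpa only [Finset.sum_singleton, one_smul, id] using
      hlim {g} (fun _ => 1) id fun _ => g₀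
  have hβS : ∀ s ∈ q '' S, ‖β s‖ ≤ C := by
    rintro _ ⟨s, hs, rfl⟩
    exact le_of_tendsto (hlim1 s)
      (Filter.Eventually.of_forall fun n => hC (ρ n) (b n) (hb n) (hb1 n) s hs)
  let y' := ∑ i ∈ t, c f i • β i
  have hyy' : ‖avg f β - y'‖ ≤ normL1 f * η := by
    refine hc σ.E β η hβ.1 hη.le ?_ f subset_rfl
    rintro i - _ ⟨g', hg', rfl⟩
    have h1 := hlim2 g' i.out
    have h2 : q i.out = i := QuotientGroup.out_eq' i
    rw [h2] at h1
    refine le_of_tendsto h1 (Filter.Eventually.of_forall fun n => ?_)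
    rw [hxdiff]
    exact hg' (ρ n) (b n) (hb n) (hb1 n)
  have hβcontr : ∀ s ∈ S, ‖∑ i ∈ t, c f i • (β (q (s * i.out)) - β (q i.out))‖ ≤ 1 / 4 := by
    intro s hs
    have e : ∑ i ∈ t, c f i • (β (q (s * i.out)) - β (q i.out)) =
        (β (q s) + σ.toHom (q s) (avg f β) - avg f β) -
          (σ.toHom (q s) (avg f β - y') - (avg f β - y')) := by
      have h1 : ∀ i : G ⧸ N, β (q (s * i.out)) - β (q i.out) =
          β (q s) + σ.toHom (q s) (β i) - β i := by
        intro i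
        have h2 : q i.out = i := QuotientGroup.out_eq' i
        have h3 : q (s * i.out) = q s * i := by
          conv_rhs => rw [← h2]
          rfl
        rw [h2, h3, hβ.2]
      simp only [h1, smul_sub, smul_add, Finset.sum_sub_distrib, Finset.sum_add_distrib,
        ← Finset.sum_smul, hcf, one_smul, y', map_sub, map_sum, map_smul]
      abel
    rw [e]
    have h1 := hfc σ hσF β hβ C hβS (q s) ⟨s, hs, rfl⟩
    have h2 : 1 / (8 * (C + 1)) * C ≤ 1 / 8 := by
      rw [div_mul_eq_mul_div, div_le_div_iff₀ (by positivity) (by norm_num)]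
      linarith
    have h3 : ‖σ.toHom (q s) (avg f β - y')‖ ≤ M * ‖avg f β - y'‖ :=
      (σ.toHom (q s)).le_of_opNorm_le (hσF.1 s hs) _
    have h4 : (M + 1) * ‖avg f β - y'‖ ≤ 1 / 8 := by
      calc (M + 1) * ‖avg f β - y'‖ ≤ (M + 1) * ((normL1 f + 1) * η) := by
            gcongr
            refine hyy'.trans ?_
            gcongr
            linarith
        _ = 1 / 8 := by simp only [η]; field_simp
    have h5 := norm_sub_le (β (q s) + σ.toHom (q s) (avg f β) - avg f β)
      (σ.toHom (q s) (avg f β - y') - (avg f β - y'))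
    have h6 := norm_sub_le (σ.toHom (q s) (avg f β - y')) (avg f β - y')
    linarith
  -- The elements of `S` at which contraction fails converge along `U`; by equicontinuity their
  -- limit `g₀` can replace them.
  obtain ⟨g₀, hg₀S, hg₀⟩ := hS.ultrafilter_le_nhds' (U.map g)
    (Filter.Eventually.of_forall (f := (U : Filter ℕ)) hgS)
  have hg₀' : Filter.Tendsto g U (𝓝 g₀) := hg₀
  have hlim3 := hlim t (c f) (fun i => g₀ * i.out) fun i => i.out
  let ζ : ℝ := 1 / (8 * (t.card * normL1 f + 1))
  have hζ : 0 < ζ := by positivity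
  have hclose : ∀ᶠ n in (U : Filter ℕ), ∀ i ∈ t,
      ‖x (g n * i.out) n - x (g₀ * i.out) n‖ ≤ ζ := by
    rw [Filter.eventually_all_finset]
    intro i _
    have h1 : Filter.Tendsto (fun n => g n * i.out) U (𝓝 (g₀ * i.out)) :=
      hg₀'.mul_const _
    exact (h1.eventually (heq (g₀ * i.out) ζ hζ)).mono fun n hn => hn n
  -- Below 3/8 at `g₀`, plus 1/8 for passing from `g₀` to `g n`: less than the 1/2 that was assumed
  -- to be exceeded.
  obtain ⟨n, hn1, hn2⟩ := (hclose.and (hlim3.eventually_lt_const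
    (lt_of_le_of_lt (hβcontr g₀ hg₀S) (by norm_num : (1 / 4 : ℝ) < 3 / 8)))).exists
  have hgn := hg n
  have e : ∑ i ∈ t, c f i • (x (g n * i.out) n - x i.out n) =
      ∑ i ∈ t, c f i • (x (g₀ * i.out) n - x i.out n) +
        ∑ i ∈ t, c f i • (x (g n * i.out) n - x (g₀ * i.out) n) := by
    rw [← Finset.sum_add_distrib]
    refine Finset.sum_congr rfl fun i _ => ?_
    rw [← smul_add]
    congr 1
    abel
  have h7 : ‖∑ i ∈ t, c f i • (x (g n * i.out) n - x (g₀ * i.out) n)‖ ≤ 1 / 8 := by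
    calc _ ≤ ∑ i ∈ t, normL1 f * ζ := by
          refine norm_sum_le_of_le _ fun i hi => ?_
          rw [norm_smul]
          exact mul_le_mul (hc1 f i) (hn1 i hi) (norm_nonneg _) hnf
      _ = t.card * normL1 f * ζ := by rw [Finset.sum_const, nsmul_eq_mul, mul_assoc]
      _ ≤ (t.card * normL1 f + 1) * ζ := by gcongr; linarith
      _ = 1 / 8 := by simp only [ζ]; field_simp
  have h8 : 1 / 2 < ‖∑ i ∈ t, c f i • (x (g n * i.out) n - x i.out n)‖ := hgn
  rw [e] at h8
  have h9 := norm_add_le (∑ i ∈ t, c f i • (x (g₀ * i.out) n - x i.out n))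
    (∑ i ∈ t, c f i • (x (g n * i.out) n - x (g₀ * i.out) n))
  linarith

end UniformContraction

/-! ### From a contraction to fixed points and a Kazhdan projection -/

section ContractionKazhdan

variable {G : Type*} [Group G] [TopologicalSpace G]

/-- A cocycle that vanishes on a generating set vanishes. -/
theorem BanachRep.cocycle_eq_zero {ρ : BanachRep G} {T : Set G} (hT : Subgroup.closure T = ⊤)
    {b : G → ρ.E} (hb : b ∈ ρ.Z1) (h : ∀ g ∈ T, b g = 0) (g : G) : b g = 0 := by
  have hg : g ∈ Subgroup.closure T := hT ▸ Subgroup.mem_top g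
  induction hg using Subgroup.closure_induction with
  | mem x hx => exact h x hx
  | one => exact BanachRep.cocycle_one hb
  | mul x y _ _ hx hy => rw [hb.2, hx, hy, map_zero, add_zero]
  | inv x _ hx =>
    have := hb.2 x⁻¹ x
    rwa [inv_mul_cancel, BanachRep.cocycle_one hb, hx, map_zero, add_zero, eq_comm] at this

theorem BanachRep.moved_mem_Z1 {ρ : BanachRep G} {b : G → ρ.E} (hb : b ∈ ρ.Z1) (x : ρ.E) :
    (fun g => b g + ρ.toHom g x - x) ∈ ρ.Z1 := by
  have h := ρ.Z1.sub_mem hb (ρ.sub_toHom_mem_Z1 x)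
  convert h using 1
  ext g
  simp only [Pi.sub_apply]
  abel

variable [IsTopologicalGroup G] [LocallyCompactSpace G]

theorem BanachRep.avg_toHom_sub (ρ : BanachRep G) {f : C_c(G, ℂ)}
    (hf : haarIntegral (fun g => f g) = 1) (x : ρ.E) :
    avg f (fun g => ρ.toHom g x - x) = ρ.op f x - x := by
  rw [avg_sub f (ρ.continuous_orbit x) continuous_const, avg_const, hf, one_smul]
  rfl

/-- If averaging contracts the displacement of an affine action, then it has a fixed point. -/
theorem BanachRep.exists_eq_sub_of_contracting {ρ : BanachRep G} {T : Set G} (hT : IsCompact T)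
    (hTgen : Subgroup.closure T = ⊤) {f : C_c(G, ℂ)} {C : ℝ}
    (hC : ∀ b ∈ ρ.Z1, ∀ D : ℝ, (∀ s ∈ T, ‖b s‖ ≤ D) → ∀ g ∈ tsupport f, ‖b g‖ ≤ C * D)
    (hf : ∀ b ∈ ρ.Z1, ∀ D : ℝ, (∀ s ∈ T, ‖b s‖ ≤ D) →
      ∀ g ∈ T, ‖b g + ρ.toHom g (avg f b) - avg f b‖ ≤ 1 / 2 * D)
    {b : G → ρ.E} (hb : b ∈ ρ.Z1) : ∃ x, ∀ g, b g = x - ρ.toHom g x := by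
  obtain ⟨D, hD⟩ := hT.exists_bound_of_continuousOn hb.1.continuousOn
  let mv : ρ.E → G → ρ.E := fun x g => b g + ρ.toHom g x - x
  have hmv : ∀ x, mv x ∈ ρ.Z1 := BanachRep.moved_mem_Z1 hb
  -- `mv x` is the cocycle seen from the base point `x`. Each move to its average halves the
  -- displacement, which also controls the length of the next move, so the points form a Cauchy
  -- sequence.
  let X : ℕ → ρ.E := fun n => Nat.rec 0 (fun _ x => x + avg f (mv x)) n
  have hX : ∀ n, X (n + 1) = X n + avg f (mv (X n)) := fun n => rfl
  have hbd : ∀ n, ∀ s ∈ T, ‖mv (X n) s‖ ≤ D / 2 ^ n := by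
    intro n
    induction n with
    | zero =>
      intro s hs
      simpa [mv, X] using hD s hs
    | succ n ih =>
      intro s hs
      have h1 := hf _ (hmv (X n)) _ ih s hs
      have e : mv (X (n + 1)) s =
          mv (X n) s + ρ.toHom s (avg f (mv (X n))) - avg f (mv (X n)) := by
        simp only [hX, mv, map_add]
        abel
      rw [e]
      refine h1.trans_eq ?_
      rw [pow_succ]
      field_simp
  have hcau : CauchySeq X := by
    refine cauchySeq_of_le_geometric_two (C := 2 * (normL1 f * (C * D))) fun n => ?_
    rw [dist_eq_norm, norm_sub_rev, hX, add_sub_cancel_left]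
    refine (norm_avg_le f (hC _ (hmv _) _ (hbd n))).trans_eq ?_
    field_simp
  obtain ⟨x, hx⟩ := cauchySeq_tendsto_of_complete hcau
  refine ⟨x, fun g => ?_⟩
  have h0 : mv x g = 0 := by
    refine BanachRep.cocycle_eq_zero hTgen (hmv x) (fun s hs => ?_) g
    have h1 : Filter.Tendsto (fun n => mv (X n) s) Filter.atTop (𝓝 (mv x s)) :=
      ((((ρ.toHom s).continuous.tendsto x).comp hx).const_add (b s)).sub hx
    have h2 : Filter.Tendsto (fun n : ℕ => D / 2 ^ n) Filter.atTop (𝓝 0) := by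
      have := (tendsto_pow_atTop_nhds_zero_of_lt_one (r := (1 / 2 : ℝ))
        (by norm_num) (by norm_num)).const_mul D
      simpa [div_eq_mul_inv] using this
    exact tendsto_nhds_unique h1 (squeeze_zero_norm (fun n => hbd n s hs) h2)
  have h1 : b g + ρ.toHom g x - x = 0 := h0
  rw [← sub_eq_zero, ← h1]
  abel

/-- If averaging contracts the displacement of a linear action, then its powers converge to a
projection on the space of invariant vectors. -/
theorem BanachRep.exists_projection_of_contracting {ρ : BanachRep G} {T : Set G} {M : ℝ}
    (hM : 0 ≤ M) (hTM : ∀ g ∈ T, ‖ρ.toHom g‖ ≤ M)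
    (hTgen : Subgroup.closure T = ⊤) {f : C_c(G, ℂ)} (hf1 : haarIntegral (fun g => f g) = 1) {C : ℝ}
    (hC0 : 0 ≤ C)
    (hC : ∀ b ∈ ρ.Z1, ∀ D : ℝ, (∀ s ∈ T, ‖b s‖ ≤ D) → ∀ g ∈ tsupport f, ‖b g‖ ≤ C * D)
    (hf : ∀ b ∈ ρ.Z1, ∀ D : ℝ, (∀ s ∈ T, ‖b s‖ ≤ D) →
      ∀ g ∈ T, ‖b g + ρ.toHom g (avg f b) - avg f b‖ ≤ 1 / 2 * D) :
    ∃ P : ρ.E →L[ℂ] ρ.E, IsIdempotentElem P ∧ LinearMap.range P.toLinearMap = ρ.invariants ∧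
      ∀ n : ℕ, ‖P - ρ.op f ^ n‖ ≤ 2 * (normL1 f * (C * (M + 1))) / 2 ^ n := by
  have hn := normL1_nonneg f
  have hb : ∀ x, (fun g => ρ.toHom g x - x) ∈ ρ.Z1 := fun x => by
    simpa using BanachRep.moved_mem_Z1 ρ.Z1.zero_mem x
  let A := ρ.op f
  have hdisp : ∀ n x, ∀ s ∈ T, ‖ρ.toHom s ((A ^ n) x) - (A ^ n) x‖ ≤ (M + 1) * ‖x‖ / 2 ^ n := by
    intro n x
    induction n with
    | zero =>
      intro s hs
      have h1 := (ρ.toHom s).le_of_opNorm_le (hTM s hs) x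
      have h2 := norm_sub_le (ρ.toHom s x) x
      simp only [pow_zero, div_one]
      exact h2.trans (by linarith)
    | succ n ih =>
      intro s hs
      have h1 := hf _ (hb ((A ^ n) x)) _ ih s hs
      rw [ρ.avg_toHom_sub hf1] at h1
      have e : ρ.toHom s ((A ^ (n + 1)) x) - (A ^ (n + 1)) x =
          ρ.toHom s ((A ^ n) x) - (A ^ n) x + ρ.toHom s (A ((A ^ n) x) - (A ^ n) x) -
            (A ((A ^ n) x) - (A ^ n) x) := by
        rw [pow_succ', mul_apply_eq_comp, map_sub]
        abel
      rw [e]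
      refine h1.trans_eq ?_
      rw [pow_succ]
      field_simp
  -- The vector `A ^ (n + 1) x - A ^ n x` is the average over `f` of the displacement of `A ^ n x`,
  -- which decays geometrically.
  have hstep : ∀ n, dist (A ^ n) (A ^ (n + 1)) ≤ 2 * (normL1 f * (C * (M + 1))) / 2 / 2 ^ n := by
    intro n
    rw [dist_eq_norm, norm_sub_rev]
    refine ContinuousLinearMap.opNorm_le_bound _ (by positivity) fun x => ?_
    have e : (A ^ (n + 1) - A ^ n) x = avg f fun g => ρ.toHom g ((A ^ n) x) - (A ^ n) x := by
      rw [ρ.avg_toHom_sub hf1, pow_succ', sub_apply, mul_apply_eq_comp]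
    rw [e]
    refine (norm_avg_le f (hC _ (hb _) _ (hdisp n x))).trans_eq ?_
    field_simp
  obtain ⟨P, hP⟩ := cauchySeq_tendsto_of_complete (cauchySeq_of_le_geometric_two hstep)
  have hPx : ∀ x, Filter.Tendsto (fun n => (A ^ n) x) Filter.atTop (𝓝 (P x)) := fun x =>
    ((ContinuousLinearMap.apply ℂ ρ.E x).continuous.tendsto P).comp hP
  have hPinv : ∀ x, P x ∈ ρ.invariants := by
    intro x g
    refine sub_eq_zero.1 (BanachRep.cocycle_eq_zero hTgen (hb (P x)) (fun s hs => ?_) g)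
    have h1 := (((ρ.toHom s).continuous.tendsto (P x)).comp (hPx x)).sub (hPx x)
    have h2 : Filter.Tendsto (fun n : ℕ => (M + 1) * ‖x‖ / 2 ^ n) Filter.atTop (𝓝 0) := by
      have := (tendsto_pow_atTop_nhds_zero_of_lt_one (r := (1 / 2 : ℝ))
        (by norm_num) (by norm_num)).const_mul ((M + 1) * ‖x‖)
      simpa [div_eq_mul_inv] using this
    exact tendsto_nhds_unique h1 (squeeze_zero_norm (fun n => hdisp n x s hs) h2)
  have hPfix : ∀ x ∈ ρ.invariants, P x = x := by
    intro x hx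
    have h1 : A x = x := by
      have h2 := ρ.avg_toHom_sub hf1 x
      have h3 : (fun g => ρ.toHom g x - x) = fun _ => 0 := by
        ext g
        rw [hx g, sub_self]
      rw [h3, avg_const, smul_zero] at h2
      exact (sub_eq_zero.1 h2.symm)
    have h2 : ∀ n : ℕ, (A ^ n) x = x := by
      intro n
      induction n with
      | zero => rfl
      | succ n ih => rw [pow_succ', mul_apply_eq_comp, ih, h1]
    have h3 := hPx x
    simp only [h2] at h3
    exact tendsto_nhds_unique h3 tendsto_const_nhds
  refine ⟨P, ?_, ?_, fun n => ?_⟩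
  · ext x
    exact hPfix _ (hPinv x)
  · ext x
    constructor
    · rintro ⟨y, rfl⟩
      exact hPinv y
    · exact fun hx => ⟨x, hPfix x hx⟩
  · rw [← dist_eq_norm, dist_comm]
    exact dist_le_of_le_geometric_two_of_tendsto hstep hP n

/-- The converse of `exists_contracting_of_kazhdan`. -/
theorem kazhdan_of_contracting [T2Space G] {T : Set G} (hT : IsCompact T)
    (hTsymm : ∀ g ∈ T, g⁻¹ ∈ T) (hTone : (1 : G) ∈ T) (hTgen : Subgroup.closure T = ⊤)
    {M : ℝ} (hM : 1 ≤ M) {F : Set (BanachRep G)} (hF : ∀ σ ∈ F, ∀ g ∈ T, ‖σ.toHom g‖ ≤ M)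
    {f : C_c(G, ℂ)} (hf1 : haarIntegral (fun g => f g) = 1)
    (hf : ∀ σ ∈ F, ∀ β ∈ σ.Z1, ∀ D : ℝ, (∀ s ∈ T, ‖β s‖ ≤ D) →
        ∀ g ∈ T, ‖β g + σ.toHom g (avg f β) - avg f β‖ ≤ 1 / 2 * D) :
    HasKazhdanProjection F ∧ ∀ σ ∈ F, Subsingleton σ.H1 := by
  obtain ⟨C, hC0, hC⟩ := BddRep.exists_bound hT hTsymm hTone hTgen hM
    f.hasCompactSupport.isCompact
  have hC' : ∀ σ ∈ F, ∀ b ∈ σ.Z1, ∀ D : ℝ, (∀ s ∈ T, ‖b s‖ ≤ D) →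
      ∀ g ∈ tsupport f, ‖b g‖ ≤ C * D := fun σ hσ b hb D hD g hg =>
    (hC ⟨σ, hF σ hσ⟩ g hg).2 b hb D hD
  refine ⟨?_, fun σ hσ => BanachRep.subsingleton_H1 fun b hb =>
    BanachRep.exists_eq_sub_of_contracting hT hTgen (hC' σ hσ) (hf σ hσ) hb⟩
  have hM0 : 0 ≤ M := by linarith
  choose p hpid hprange hpn using fun σ : F => BanachRep.exists_projection_of_contracting hM0
    (hF σ.1 σ.2) hTgen hf1 hC0 (hC' σ.1 σ.2) (hf σ.1 σ.2)
  -- Convolution powers start at exponent 1, as `C_c(G)` need not have a unit.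
  have hpow : ∀ n : ℕ, ∃ k : C_c(G, ℂ), haarIntegral (fun g => k g) = 1 ∧
      ∀ σ : BanachRep G, σ.op k = σ.op f ^ (n + 1) := by
    intro n
    induction n with
    | zero => exact ⟨f, hf1, fun σ => by simp⟩
    | succ n ih =>
      obtain ⟨k, hk1, hk⟩ := ih
      exact ⟨convolve f k, by rw [haarIntegral_convolve, hf1, hk1, mul_one],
        fun σ => by rw [σ.op_convolve, hk, ← pow_succ']⟩
  have hmem : p ∈ closureInCF F {f | haarIntegral (fun g => f g) = 1} := by
    intro ε hε
    have hlim : Filter.Tendsto (fun n : ℕ =>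
        ENNReal.ofReal (2 * (normL1 f * (C * (M + 1))) / 2 ^ n)) Filter.atTop (𝓝 0) := by
      have := (tendsto_pow_atTop_nhds_zero_of_lt_one (r := (1 / 2 : ℝ))
        (by norm_num) (by norm_num)).const_mul (2 * (normL1 f * (C * (M + 1))))
      rw [mul_zero] at this
      have h2 := ENNReal.tendsto_ofReal this
      rw [ENNReal.ofReal_zero] at h2
      refine h2.congr fun n => ?_
      rw [one_div, inv_pow, div_eq_mul_inv]
    obtain ⟨n, hn⟩ := ((hlim.comp (Filter.tendsto_add_atTop_nat 1)).eventually_lt_const hε).exists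
    obtain ⟨k, hk1, hk⟩ := hpow n
    refine ⟨k, hk1, lt_of_le_of_lt (iSup_le fun σ => ?_) hn⟩
    change ‖p σ - σ.1.op k‖ₑ ≤ _
    rw [hk, ← ofReal_norm]
    exact ENNReal.ofReal_le_ofReal (hpn σ (n + 1))
  refine ⟨p, ⟨?_, ?_, hmem, fun σ => ⟨hpid σ, hprange σ⟩⟩⟩
  · intro ε hε
    obtain ⟨k, -, hk⟩ := hmem ε hε
    exact ⟨k, trivial, hk⟩
  · exact funext fun σ => hpid σ

end ContractionKazhdan

/-! ### Adding finitely many relators -/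

section CompactPresentation

/-- The quotient of a compactly presented group by the normal closure of a finite set is
compactly presented. -/
theorem IsCompactlyPresented.quotient_normalClosure {G : Type*} [Group G] [TopologicalSpace G]
    (hG : IsCompactlyPresented G) {A : Set G} (hA : A.Finite) :
    IsCompactlyPresented (G ⧸ Subgroup.normalClosure A) := by
  obtain ⟨T, hT, hTgen, n, R, hRn, hR⟩ := hG
  let N := Subgroup.normalClosure A
  let q : G →* G ⧸ N := QuotientGroup.mk' N
  let T' : Set (G ⧸ N) := q '' T
  let e : T → T' := fun t => ⟨q t, t, t.2, rfl⟩
  have he : Function.Surjective e := by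
    rintro ⟨_, t, ht, rfl⟩
    exact ⟨⟨t, ht⟩, rfl⟩
  let π : FreeGroup T →* G := FreeGroup.lift fun t : T => (t : G)
  let π' : FreeGroup T' →* G ⧸ N := FreeGroup.lift fun t : T' => (t : G ⧸ N)
  let μ : FreeGroup T →* FreeGroup T' := FreeGroup.map e
  have hμ : Function.Surjective μ := FreeGroup.map_surjective he
  have hπμ : π'.comp μ = q.comp π := by
    ext t
    simp [π, π', μ, e]
  have hπ : Function.Surjective π := by
    rw [← MonoidHom.range_eq_top, ← hTgen, FreeGroup.range_lift_eq_closure]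
    simp
  have hw : ∀ a : G, ∃ w : List (T × Bool), π (FreeGroup.mk w) = a := by
    intro a
    obtain ⟨y, rfl⟩ := hπ a
    obtain ⟨w, rfl⟩ := Quot.exists_rep y
    exact ⟨w, rfl⟩
  choose w hw using hw
  obtain ⟨k, hk⟩ := (hA.image fun a => (w a).length).bddAbove
  let m : List (T × Bool) → List (T' × Bool) := List.map fun p => (e p.1, p.2)
  refine ⟨T', hT.image continuous_quot_mk, ?_, max n k, m '' (R ∪ w '' A), ?_, ?_⟩
  · rw [← MonoidHom.map_closure, hTgen, ← MonoidHom.range_eq_map, QuotientGroup.range_mk']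
  · rintro _ ⟨v, hv | ⟨a, ha, rfl⟩, rfl⟩
    · simpa [m] using Or.inl (hRn v hv)
    · simpa [m] using Or.inr (hk ⟨a, ha, rfl⟩)
  · have h1 : FreeGroup.mk '' (m '' (R ∪ w '' A)) = μ '' (FreeGroup.mk '' (R ∪ w '' A)) := by
      rw [Set.image_image, Set.image_image]
      rfl
    have h2 : π '' (FreeGroup.mk '' (w '' A)) = A := by
      rw [Set.image_image, Set.image_image]
      simp [hw]
    have h3 : N = (Subgroup.normalClosure (FreeGroup.mk '' (w '' A))).map π := by
      rw [Subgroup.map_normalClosure _ _ hπ, h2]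
    -- The preimage of `N = π(⟪w(A)⟫)` is the join of `⟪w(A)⟫` with `ker π = ⟪R⟫`.
    have h4 : Subgroup.normalClosure (FreeGroup.mk '' (R ∪ w '' A)) = N.comap π := by
      rw [h3, Subgroup.comap_map_eq, hR, Set.image_union, Subgroup.normalClosure_union, sup_comm]
    rw [h1, ← Subgroup.map_normalClosure _ _ hμ, h4]
    -- The map `e` may identify letters; since `μ` is onto, the kernel of `π'` is still the image of
    -- its preimage.
    have h5 : N.comap π = π'.ker.comap μ := by
      rw [MonoidHom.comap_ker, hπμ, ← MonoidHom.comap_ker, QuotientGroup.ker_mk']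
    rw [h5, Subgroup.map_comap_eq_self_of_surjective hμ]

end CompactPresentation

/-! ### Finite exhaustion of a discrete subgroup -/

section Exhaustion

open scoped Pointwise in
/-- A discrete subgroup of a compactly generated group is the increasing union of finite sets. -/
theorem Subgroup.exists_finite_exhaustion {G : Type*} [Group G] [TopologicalSpace G]
    [IsTopologicalGroup G] [LocallyCompactSpace G] [T2Space G] {S : Set G} (hS : IsCompact S)
    (hSsymm : ∀ g ∈ S, g⁻¹ ∈ S) (hSone : (1 : G) ∈ S) (hSgen : Subgroup.closure S = ⊤)
    (N : Subgroup G) [DiscreteTopology N] :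
    ∃ A : ℕ → Set G, (∀ m, (A m).Finite) ∧ (∀ m, A m ⊆ N) ∧
      ∀ g ∈ N, ∀ᶠ m in Filter.atTop, g ∈ A m := by
  have hNcl : IsClosed (N : Set G) := Subgroup.isClosed_of_discrete
  have hcomp : ∀ m : ℕ, IsCompact (S ^ m) := by
    intro m
    induction m with
    | zero => simp
    | succ m ih => rw [pow_succ]; exact ih.mul hS
  -- `N ∩ S ^ m` is compact, as `N` is closed, and discrete, hence finite.
  refine ⟨fun m => Subtype.val '' ((Subtype.val : N → G) ⁻¹' (S ^ m)), fun m => ?_, ?_, ?_⟩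
  · exact ((hNcl.isClosedEmbedding_subtypeVal.isCompact_preimage (hcomp m)).finite_of_discrete).image
      _
  · rintro m _ ⟨g, -, rfl⟩
    exact g.2
  · intro g hg
    obtain ⟨m, hm⟩ := hS.exists_subset_pow hSsymm hSone hSgen (isCompact_singleton (x := g))
    filter_upwards [Filter.eventually_ge_atTop m] with k hk
    exact ⟨⟨g, hg⟩, Set.pow_subset_pow_right hSone hk (hm rfl), rfl⟩

end Exhaustion

/-! ### Transferring the contraction to the quotient group -/

section QuotientContraction

/-- Contraction of the affine actions of `G` that are trivial on `N` gives a Kazhdan projection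
and the vanishing of the first cohomology for `G ⧸ N`. -/
theorem BddRep.kazhdan_factoring_of_contracting {G : Type*} [Group G] [TopologicalSpace G]
    [IsTopologicalGroup G] [LocallyCompactSpace G] [T2Space G] {S : Set G} (hS : IsCompact S)
    (hSsymm : ∀ g ∈ S, g⁻¹ ∈ S) (hSone : (1 : G) ∈ S) (hSgen : Subgroup.closure S = ⊤) {M : ℝ}
    (hM : 1 ≤ M) (N : Subgroup G) [N.Normal] (hN : IsClosed (N : Set G)) {F : Set (BddRep S M)}
    {ψ : C_c(G, ℂ)} (hψ : haarIntegral (fun g => ψ g) = 1)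
    (hc : ∀ ρ ∈ F, (∀ n ∈ N, ρ.1.toHom n = 1) → ∀ b ∈ ρ.1.Z1, (∀ n ∈ N, b n = 0) →
        ∀ D : ℝ, (∀ s ∈ S, ‖b s‖ ≤ D) →
          ∀ g ∈ S, ‖b g + ρ.1.toHom g (avg ψ b) - avg ψ b‖ ≤ 1 / 2 * D) :
    HasKazhdanProjection (BddRep.factoring F N) ∧
      ∀ σ ∈ BddRep.factoring F N, Subsingleton σ.H1 := by
  let q : G → G ⧸ N := fun g => (g : G ⧸ N)
  -- The average of a cocycle of `G ⧸ N` against `k` is that of its pullback against `ψ`, so `k`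
  -- contracts as `ψ` does.
  obtain ⟨k, hk⟩ := exists_avg_quotient N hN ψ
  have hk1 : haarIntegral (fun g => k g) = 1 := by
    rw [haarIntegral_eq_avg_one, hk ℂ _ continuous_const, avg_one, hψ]
  have hq1 : ∀ n ∈ N, (n : G ⧸ N) = 1 := fun n hn => (QuotientGroup.eq_one_iff n).2 hn
  have hq : Continuous q := continuous_quot_mk
  refine kazhdan_of_contracting (T := q '' S) (hS.image hq)
    (by rintro _ ⟨g, hg, rfl⟩; exact ⟨g⁻¹, hSsymm g hg, rfl⟩) ⟨1, hSone, rfl⟩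
    (by
      have := (MonoidHom.map_closure (QuotientGroup.mk' N) S).symm
      rw [hSgen, ← MonoidHom.range_eq_map, QuotientGroup.range_mk'] at this
      exact this)
    hM (by rintro σ ⟨hσ, -⟩ _ ⟨g, hg, rfl⟩; exact hσ g hg) hk1 ?_
  rintro σ ⟨hσ, hσF⟩ β hβ D hD _ ⟨g, hg, rfl⟩
  rw [hk σ.E β hβ.1]
  refine hc ⟨σ.pullback N, hσ⟩ hσF (fun n hn => ?_) (fun g => β g)
    (BanachRep.pullback_mem_Z1 hβ) (fun n hn => ?_) D (fun s hs => hD _ ⟨s, hs, rfl⟩) g hg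
  · change σ.toHom (n : G ⧸ N) = 1
    rw [hq1 n hn, map_one]
  · rw [hq1 n hn]
    exact BanachRep.cocycle_one hβ

end QuotientContraction

theorem theorem4p12 {G : Type*} [Group G] [TopologicalSpace G] [IsTopologicalGroup G]
    [LocallyCompactSpace G] [T2Space G] [TopologicalSpace.SeparableSpace G]
    (S : Set G) (hS : IsCompact S) (hSsymm : ∀ g ∈ S, g⁻¹ ∈ S) (hSone : (1 : G) ∈ S)
    (hSgen : Subgroup.closure S = ⊤)
    (hG : IsCompactlyPresented G)
    (M : ℝ) (hM : 1 < M)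
    (N : Subgroup G) [N.Normal] [DiscreteTopology N]
    (F : Set (BddRep S M)) (hF : IsClosed F)
    (hK : HasKazhdanProjection (BddRep.factoring F N))
    (hH1 : ∀ σ ∈ BddRep.factoring F N, Subsingleton σ.H1) :
    ∃ (N' : Subgroup G) (_ : N'.Normal), N' ≤ N ∧
      IsCompactlyPresented (G ⧸ N') ∧
      HasKazhdanProjection (BddRep.factoring F N') ∧
      ∀ σ ∈ BddRep.factoring F N', Subsingleton σ.H1 := by
  have hNcl : IsClosed (N : Set G) := Subgroup.isClosed_of_discrete
  obtain ⟨A, hAfin, hAN, hA⟩ := N.exists_finite_exhaustion hS hSsymm hSone hSgen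
  obtain ⟨ψ, hψ, m, hm⟩ := BddRep.exists_contracting hS hSsymm hSone hSgen hM.le N hNcl hF hK hH1
    (A := fun m => Subgroup.normalClosure (A m))
    fun g hg => (hA g hg).mono fun m hm => Subgroup.subset_normalClosure hm
  have hle : Subgroup.normalClosure (A m) ≤ N := Subgroup.normalClosure_le_normal (hAN m)
  have : DiscreteTopology (Subgroup.normalClosure (A m)) :=
    DiscreteTopology.of_subset (s := (N : Set G)) inferInstance hle
  exact ⟨Subgroup.normalClosure (A m), inferInstance, hle,
    hG.quotient_normalClosure (hAfin m),
    BddRep.kazhdan_factoring_of_contracting hS hSsymm hSone hSgen hM.le _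
      Subgroup.isClosed_of_discrete hψ hm⟩
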